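/- **Setting.** Consider a two-player zero-sum Markov game with finite state space $\mathcal S$, finite action spaces $\mathcal A_1,\mathcal A_2$, horizon $T$, initial distribution $P_I$, transition function $P_T$, reward distributions $P_R(\cdot\mid s,a^1,a^2)$ with mean $R(s,a^1,a^2)$, and discount factor $\gamma\in[0,1]$. Player 1 receives $r_t\sim P_R(\cdot\mid s_t,a_t^1,a_t^2)$ and player 2 receives $-r_t$. For a profile $\pi=(\pi_1,\pi_2)$ of Markov policies let $v_1(\pi)=\mathbb E_\pi[\sum_{t=1}^T\gamma^{t-1}r_t]=-v_2(\pi)$, and let $V_{1,t}$, $Q_{1,t}$ be its state and state-action value functions, i.e. $V_{1,T+1}=0$, $Q_{1,t}(s,a)=R(s,a)+\gamma\sum_{s'}P_T(s'\mid s,a)V_{1,t+1}(s')$, $V_{1,t}(s)=\sum_{a}\pi_{1,t}(a^1\mid s)\pi_{2,t}(a^2\mid s)Q_{1,t}(s,a)$, where $a=(a^1,a^2)$. Let $\Pi=\Pi_1\times\Pi_2$ be a product of non-empty classes of policies, $\pi^e$ a target profile, $\pi^b$ a behavior profile, and $$v^{\mathrm{exp}}_\Pi(\pi^e)=\max_{\pi_1\in\Pi_1}v_1(\pi_1,\pi_2^e)+\max_{\pi_2\in\Pi_2}v_2(\pi_1^e,\pi_2).$$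 For a profile $\pi$ let $\eta_t=\frac{\pi_{1,t}(a_t^1\mid s_t)\pi_{2,t}(a_t^2\mid s_t)}{\pi^b_{1,t}(a_t^1\mid s_t)\pi^b_{2,t}(a_t^2\mid s_t)}$, $\rho_t=\prod_{l\le t}\eta_l$, $\rho_0=1$. **Estimator.** The data are $n$ i.i.d. trajectories generated by $\pi^b$, with indices partitioned at random, independently of the data, into $K\ge1$ folds of equal size (up to rounding if $K\nmid n$); $k(i)$ is the fold of $i$. For each fold $k$ let $\hat R^{-k},\hat P_T^{-k},\hat\pi_1^{b,-k},\hat\pi_2^{b,-k}$ be estimates computed from the data outside fold $k$; for each profile $\pi$ let $\hat Q^{-k}_{1,t},\hat V^{-k}_{1,t}$ be obtained from the above recursion with $\hat R^{-k},\hat P_T^{-k}$ in place of $R,P_T$, and let $\hat\rho^{-k}_t$ be $\rho_t$ with $\hat\pi^{b,-k}$ in place of $\pi^b$. Put $$\hat v_1^{\mathrm{DR}}(\pi)=\frac1n\sum_{i=1}^n\sum_{t=1}^T\gamma^{t-1}\Big(\hat\rho_t^{-k(i)}\big(r_{i,t}-\hat Q_{1,t}^{-k(i)}\big)+\hat\rho_{t-1}^{-k(i)}\hat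 V_{1,t}^{-k(i)}\Big)$$ (all terms evaluated on the $i$-th trajectory), $\hat v_2^{\mathrm{DR}}=-\hat v_1^{\mathrm{DR}}$, and $\hat v^{\mathrm{exp}}_{\mathrm{DR}}(\pi^e)=\max_{\pi_1\in\Pi_1}\hat v^{\mathrm{DR}}_1(\pi_1,\pi_2^e)+\max_{\pi_2\in\Pi_2}\hat v_2^{\mathrm{DR}}(\pi_1^e,\pi_2)$. **Covering numbers.** For $m\ge1$ state trajectories $(s_{i,t})_{t\le T}$, $i\le m$, let $H_m(\pi^\alpha,\pi^\beta)$ be the fraction of indices $i$ such that $\pi^\alpha_{1,t}(s_{i,t})\ne\pi^\beta_{1,t}(s_{i,t})$ for some $t$ or $\pi^\alpha_{2,t}(s_{i,t})\ne\pi^\beta_{2,t}(s_{i,t})$ for some $t$. Let $N_H(\epsilon,\Pi)$ be the supremum, over $m\ge1$ and over all such collections of state trajectories, of the smallest number of elements of $\Pi$ that $\epsilon$-cover $\Pi$ for $H_m$, and let $\kappa(\Pi)=\int_0^\infty\sqrt{\log N_H(\epsilon^2,\Pi)}\,d\epsilon$. **Theorem.** Let $B,R_{\max},D_1,D_2,\omega,\alpha_1,\alpha_2$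 be constants with $D_1,D_2,\alpha_1,\alpha_2>0$, $0\le\omega<1/2$ and $\alpha_1+\alpha_2\ge1/2$. Assume: 1. $|r_t|\le R_{\max}$ almost surely, and for every profile $\pi$ in $\Pi\cup(\Pi_1\times\{\pi^e_2\})\cup(\{\pi^e_1\}\times\Pi_2)$ (which is $\Pi$ if $\pi^e\in\Pi$) the density ratio is bounded by $B$: $\pi_{1,t}(a^1\mid s)\pi_{2,t}(a^2\mid s)\le B\,\pi^b_{1,t}(a^1\mid s)\pi^b_{2,t}(a^2\mid s)$ for all $t,s,a^1,a^2$. 2. For the same profiles, almost surely, $0\le\hat\rho_t^{-k}\le B^t$ and $|\hat Q_{1,t}^{-k}|\le(T+1-t)R_{\max}$ for all $k$ and $1\le t\le T$. 3. $N_H(\epsilon,\Pi)\le D_1\exp(D_2\epsilon^{-\omega})$ for all $0<\epsilon<1$. 4. For all $k$, all $1\le t\le t'\le T$ and each fixed choice of $s_{l},a_{l}$ ($t<l\le t'$), as $n\to\infty$, $$\mathbb E\Big[\Big(\hat R^{-k}(s_{t'},a_{t'})\prod_{l=t}^{t'-1}\hat P_T^{-k}(s_{l+1}\mid s_l,a_l)-R(s_{t'},a_{t'})\prod_{l=t}^{t'-1}P_T(s_{l+1}\mid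 s_l,a_l)\Big)^2\Big]=o(n^{-2\alpha_1}),$$ the expectation being over the sample and over an independent pair $(s_t,a_t)$ with its distribution at step $t$ under $\pi^b$. 5. For all $k$ and $1\le t\le T$, with the expectation over the sample and over an independent trajectory generated by $\pi^b$, $$\mathbb E\Big[\Big(\prod_{l=1}^t\frac1{\hat\pi^{b,-k}_{1,l}(a^1_l\mid s_l)\hat\pi^{b,-k}_{2,l}(a^2_l\mid s_l)}-\prod_{l=1}^t\frac1{\pi^b_{1,l}(a_l^1\mid s_l)\pi^b_{2,l}(a_l^2\mid s_l)}\Big)^2\Big]=o(n^{-2\alpha_2}).$$ 6. $\Upsilon^*_{\mathrm{DR}}:=\sup_{\pi\in\Pi}\mathbb E_{\pi^b}\Big[\Big(\sum_{t=1}^T\gamma^{t-1}\big(\rho_t(r_t-Q_{1,t})+\rho_{t-1}V_{1,t}\big)\Big)^2\Big]>0$. Then there is a constant $C>0$, independent of $n$ and $\delta$, such that for every $\delta>0$ there is $N_\delta>0$ such that for all $n\ge N_\delta$, with probability at least $1-2\delta$, $$\big|v^{\mathrm{exp}}_\Pi(\pi^e)-\hat v^{\mathrm{exp}}_{\mathrm{DR}}(\pi^e)\big|\le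 C\Big(\kappa(\Pi)+\sqrt{\log(1/\delta)}\Big)\sqrt{\Upsilon^*_{\mathrm{DR}}/n}.$$ (For $\delta\ge1/2$ the claim is void.) -/

import Mathlib

open MeasureTheory Filter Topology

noncomputable section

namespace ZeroSumOPE

/-- A Markov policy over the horizon `T`: at every step, a map from states to
probability distributions over the (finite) set of actions. -/
abbrev Policy (S A : Type*) [Fintype A] (T : ℕ) : Type _ :=
  Fin T → S → stdSimplex ℝ A

/-- A policy profile. -/
abbrev Profile (S A₁ A₂ : Type*) [Fintype A₁] [Fintype A₂] (T : ℕ) : Type _ :=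
  Policy S A₁ T × Policy S A₂ T

/-- A trajectory `(s_1, …, s_{T+1})`, `(a¹_1, …, a¹_T)`, `(a²_1, …, a²_T)`, `(r_1, …, r_T)`.
Steps are numbered from `0`, so `t : Fin T` stands for the step `t + 1`. -/
abbrev Traj (S A₁ A₂ : Type*) (T : ℕ) : Type _ :=
  (Fin (T + 1) → S) × (Fin T → A₁) × (Fin T → A₂) × (Fin T → ℝ)

section Trajectory

variable {S A₁ A₂ : Type*} {T : ℕ}

/-- The state `s_t` of a trajectory. -/
def Traj.st (τ : Traj S A₁ A₂ T) (t : Fin T) : S := τ.1 t.castSucc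

/-- The state `s_{t+1}` that follows step `t`. -/
def Traj.next (τ : Traj S A₁ A₂ T) (t : Fin T) : S := τ.1 t.succ

/-- The action of player 1 at step `t`. -/
def Traj.act₁ (τ : Traj S A₁ A₂ T) (t : Fin T) : A₁ := τ.2.1 t

/-- The action of player 2 at step `t`. -/
def Traj.act₂ (τ : Traj S A₁ A₂ T) (t : Fin T) : A₂ := τ.2.2.1 t

/-- The reward of player 1 at step `t`. -/
def Traj.rew (τ : Traj S A₁ A₂ T) (t : Fin T) : ℝ := τ.2.2.2 t

/-- The trajectory `x` with its state and its actions at step `t` replaced by those of `τ`. -/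
def splice (x τ : Traj S A₁ A₂ T) (t : Fin T) : Traj S A₁ A₂ T :=
  (Function.update x.1 t.castSucc (τ.st t),
    Function.update x.2.1 t (τ.act₁ t),
    Function.update x.2.2.1 t (τ.act₂ t),
    x.2.2.2)

end Trajectory

/-- A two-player zero-sum Markov game with finite state and action spaces
(the horizon `T` is carried by the policies and the trajectories). -/
structure Game (S A₁ A₂ : Type*) [Fintype S] where
  /-- initial state distribution -/
  init : stdSimplex ℝ S
  /-- transition probabilities -/
  trans : S → A₁ → A₂ → stdSimplex ℝ S
  /-- reward distributions (rewards of player 1; player 2 receives the opposite) -/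
  reward : S → A₁ → A₂ → ProbabilityMeasure ℝ
  /-- discount factor -/
  γ : ℝ
  γ_nonneg : 0 ≤ γ
  γ_le_one : γ ≤ 1

/-- The unknown quantities on which the doubly robust score depends: the mean reward, the
transition function, and the two behavior policies.  The same structure holds the true values
and their estimates (the latter are not required to be probabilities). -/
structure Nuisance (S A₁ A₂ : Type*) (T : ℕ) where
  R : S → A₁ → A₂ → ℝ
  P : S → A₁ → A₂ → S → ℝ
  b₁ : Fin T → S → A₁ → ℝ
  b₂ : Fin T → S → A₂ → ℝ

section Values

variable {S A₁ A₂ : Type*} [Fintype S] [Fintype A₁] [Fintype A₂] {T : ℕ}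

/-- State value function of player 1 for the profile `π` in the model `N`, by the Bellman
recursion `V_{T+1} = 0`,
`V_t(s) = ∑_{a¹,a²} π_{1,t}(a¹|s) π_{2,t}(a²|s) (R(s,a¹,a²) + γ ∑_{s'} P(s'|s,a¹,a²) V_{t+1}(s'))`. -/
def stateValue (γ : ℝ) (N : Nuisance S A₁ A₂ T) (π : Profile S A₁ A₂ T) :
    Fin (T + 1) → S → ℝ :=
  Fin.reverseInduction (motive := fun _ => S → ℝ) (fun _ => 0)
    (fun t Vnext s => ∑ a₁, ∑ a₂, π.1 t s a₁ * π.2 t s a₂ *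
      (N.R s a₁ a₂ + γ * ∑ s', N.P s a₁ a₂ s' * Vnext s'))

/-- State-action value function `Q_{1,t}(s,a¹,a²) = R(s,a¹,a²) + γ ∑_{s'} P(s'|s,a¹,a²) V_{t+1}(s')`. -/
def qValue (γ : ℝ) (N : Nuisance S A₁ A₂ T) (π : Profile S A₁ A₂ T)
    (t : Fin T) (s : S) (a₁ : A₁) (a₂ : A₂) : ℝ :=
  N.R s a₁ a₂ + γ * ∑ s', N.P s a₁ a₂ s' * stateValue γ N π t.succ s'

/-- The density ratio `η_t` of the profile `π` to the behavior policies of `N`. -/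
def ratio (N : Nuisance S A₁ A₂ T) (π : Profile S A₁ A₂ T) (τ : Traj S A₁ A₂ T)
    (t : Fin T) : ℝ :=
  (π.1 t (τ.st t) (τ.act₁ t) * π.2 t (τ.st t) (τ.act₂ t)) /
    (N.b₁ t (τ.st t) (τ.act₁ t) * N.b₂ t (τ.st t) (τ.act₂ t))

/-- The cumulative density ratio `ρ_t`. -/
def cumRatio (N : Nuisance S A₁ A₂ T) (π : Profile S A₁ A₂ T) (τ : Traj S A₁ A₂ T)
    (t : Fin T) : ℝ :=
  ∏ l ∈ Finset.Iic t, ratio N π τ l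

/-- The preceding cumulative density ratio `ρ_{t-1}` (equal to `1` at the first step). -/
def prevCumRatio (N : Nuisance S A₁ A₂ T) (π : Profile S A₁ A₂ T) (τ : Traj S A₁ A₂ T)
    (t : Fin T) : ℝ :=
  ∏ l ∈ Finset.Iio t, ratio N π τ l

/-- The doubly robust score
`∑_t γ^{t-1} (ρ_t (r_t - Q_{1,t}(s_t,a¹_t,a²_t)) + ρ_{t-1} V_{1,t}(s_t))` of one trajectory. -/
def drScore (γ : ℝ) (N : Nuisance S A₁ A₂ T) (π : Profile S A₁ A₂ T)
    (τ : Traj S A₁ A₂ T) : ℝ :=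
  ∑ t : Fin T, γ ^ (t : ℕ) *
    (cumRatio N π τ t * (τ.rew t - qValue γ N π t (τ.st t) (τ.act₁ t) (τ.act₂ t)) +
      prevCumRatio N π τ t * stateValue γ N π t.castSucc (τ.st t))

/-- `R(s_{t'},a_{t'}) ∏_{l=t}^{t'-1} P(s_{l+1} | s_l, a_l)` along a trajectory. -/
def modelProduct (N : Nuisance S A₁ A₂ T) (t t' : Fin T) (τ : Traj S A₁ A₂ T) : ℝ :=
  N.R (τ.st t') (τ.act₁ t') (τ.act₂ t') *
    ∏ l ∈ Finset.Ico t t', N.P (τ.st l) (τ.act₁ l) (τ.act₂ l) (τ.next l)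

/-- `∏_{l=1}^{t} 1 / b_l(a¹_l, a²_l | s_l)` along a trajectory. -/
def inverseBehavior (N : Nuisance S A₁ A₂ T) (t : Fin T) (τ : Traj S A₁ A₂ T) : ℝ :=
  ∏ l ∈ Finset.Iic t,
    1 / (N.b₁ l (τ.st l) (τ.act₁ l) * N.b₂ l (τ.st l) (τ.act₂ l))

/-- The mean reward function of a game. -/
def Game.meanReward (G : Game S A₁ A₂) (s : S) (a₁ : A₁) (a₂ : A₂) : ℝ :=
  ∫ r, r ∂(G.reward s a₁ a₂ : Measure ℝ)

/-- The true nuisance quantities of a game with behavior profile `πb`. -/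
def Game.nuisance (G : Game S A₁ A₂) (πb : Profile S A₁ A₂ T) : Nuisance S A₁ A₂ T where
  R := G.meanReward
  P := fun s a₁ a₂ s' => G.trans s a₁ a₂ s'
  b₁ := fun t s a => πb.1 t s a
  b₂ := fun t s a => πb.2 t s a

end Values

section Laws

variable {S A₁ A₂ : Type*} [Fintype S] [Fintype A₁] [Fintype A₂]
  [MeasurableSpace S] [MeasurableSpace A₁] [MeasurableSpace A₂] {T : ℕ}

/-- The law of a trajectory when the profile `π` is played:
`P_I(s_1) ∏_t π_{1,t}(a¹_t|s_t) π_{2,t}(a²_t|s_t) P_R(dr_t|s_t,a¹_t,a²_t) P_T(s_{t+1}|s_t,a¹_t,a²_t)`. -/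
def Game.law (G : Game S A₁ A₂) (π : Profile S A₁ A₂ T) : Measure (Traj S A₁ A₂ T) :=
  ∑ s : Fin (T + 1) → S, ∑ a₁ : Fin T → A₁, ∑ a₂ : Fin T → A₂,
    ENNReal.ofReal (G.init (s 0) *
      ∏ t : Fin T, (π.1 t (s t.castSucc) (a₁ t) * π.2 t (s t.castSucc) (a₂ t) *
        G.trans (s t.castSucc) (a₁ t) (a₂ t) (s t.succ))) •
    Measure.map (fun r : Fin T → ℝ => ((s, a₁, a₂, r) : Traj S A₁ A₂ T))
      (Measure.pi fun t => (G.reward (s t.castSucc) (a₁ t) (a₂ t) : Measure ℝ))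

/-- The discounted value `v_1(π)` of player 1 (the value of player 2 is `v_2 = -v_1`). -/
def Game.value (G : Game S A₁ A₂) (π : Profile S A₁ A₂ T) : ℝ :=
  ∫ τ, ∑ t : Fin T, G.γ ^ (t : ℕ) * τ.rew t ∂(G.law π)

/-- The exploitability restricted to the policy classes:
`max_{π₁ ∈ Pi₁} v_1(π₁, πe₂) + max_{π₂ ∈ Pi₂} v_2(πe₁, π₂)`. -/
def Game.classExploitability (G : Game S A₁ A₂) (Pi₁ : Set (Policy S A₁ T))
    (Pi₂ : Set (Policy S A₂ T)) (πe : Profile S A₁ A₂ T) : ℝ :=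
  sSup ((fun π₁ => G.value (π₁, πe.2)) '' Pi₁) + sSup ((fun π₂ => -G.value (πe.1, π₂)) '' Pi₂)

/-- `Υ*_DR`: the largest second moment, under the behavior profile, of the doubly robust score
with the true nuisance quantities, over the profiles of the class. -/
def Game.upsilonDR (G : Game S A₁ A₂) (πb : Profile S A₁ A₂ T)
    (Pi : Set (Profile S A₁ A₂ T)) : ℝ :=
  sSup ((fun π => ∫ τ, (drScore G.γ (G.nuisance πb) π τ) ^ 2 ∂(G.law πb)) '' Pi)

/-- The profiles that occur in the problem: those of `Pi₁ × Pi₂` and those that pair one of the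
target policies with a policy of the opponent's class.  This is `Pi₁ × Pi₂` itself when the target
profile belongs to it. -/
def evaluatedProfiles (Pi₁ : Set (Policy S A₁ T)) (Pi₂ : Set (Policy S A₂ T))
    (πe : Profile S A₁ A₂ T) : Set (Profile S A₁ A₂ T) :=
  Pi₁ ×ˢ Pi₂ ∪ Pi₁ ×ˢ {πe.2} ∪ {πe.1} ×ˢ Pi₂

end Laws

section CrossFitting

variable {S A₁ A₂ : Type*} [Fintype S] [Fintype A₁] [Fintype A₂]
  [MeasurableSpace S] [MeasurableSpace A₁] [MeasurableSpace A₂] {T K : ℕ}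

/-- What is observed with `n` trajectories: the assignment of the indices to `K` folds, and the
trajectories themselves. -/
abbrev Sample (S A₁ A₂ : Type*) (T K n : ℕ) : Type _ :=
  (Fin n → Fin K) × (Fin n → Traj S A₁ A₂ T)

/-- The law of the sample: the random partition is independent of the data, and the data are
`n` independent trajectories generated by the behavior profile. -/
def Game.sampleLaw (G : Game S A₁ A₂) (πb : Profile S A₁ A₂ T) {n : ℕ}
    (ν : Measure (Fin n → Fin K)) : Measure (Sample S A₁ A₂ T K n) :=
  ν.prod (Measure.pi fun _ : Fin n => G.law πb)

/-- All folds have the same size, up to rounding (exactly `n / K` when `K` divides `n`). -/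
def IsBalanced {n : ℕ} (f : Fin n → Fin K) : Prop :=
  ∀ k : Fin K, n / K ≤ (Finset.univ.filter fun i => f i = k).card ∧
    (Finset.univ.filter fun i => f i = k).card ≤ n / K + 1

/-- An estimation procedure: for every fold `k`, estimates of the nuisance quantities computed
from the trajectories outside the fold `k`. -/
abbrev Procedure (S A₁ A₂ : Type*) (T K n : ℕ) : Type _ :=
  (f : Fin n → Fin K) → (k : Fin K) → ({i : Fin n // f i ≠ k} → Traj S A₁ A₂ T) →
    Nuisance S A₁ A₂ T

/-- All estimates are measurable functions of the data. -/
structure Procedure.IsMeasurable {n : ℕ} (e : Procedure S A₁ A₂ T K n) : Prop where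
  R : ∀ f k s a₁ a₂, Measurable fun D => (e f k D).R s a₁ a₂
  P : ∀ f k s a₁ a₂ s', Measurable fun D => (e f k D).P s a₁ a₂ s'
  b₁ : ∀ f k t s a, Measurable fun D => (e f k D).b₁ t s a
  b₂ : ∀ f k t s a, Measurable fun D => (e f k D).b₂ t s a

/-- The estimates for the fold `k` on a given sample. -/
def Procedure.fit {n : ℕ} (e : Procedure S A₁ A₂ T K n) (ω : Sample S A₁ A₂ T K n)
    (k : Fin K) : Nuisance S A₁ A₂ T :=
  e ω.1 k fun i => ω.2 i

/-- The cross-fitted doubly robust value estimator of `v_1(π)`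
(the estimator of `v_2(π)` is its opposite). -/
def drValue {n : ℕ} (γ : ℝ) (e : Procedure S A₁ A₂ T K n) (ω : Sample S A₁ A₂ T K n)
    (π : Profile S A₁ A₂ T) : ℝ :=
  (1 / (n : ℝ)) * ∑ i : Fin n, drScore γ (e.fit ω (ω.1 i)) π (ω.2 i)

/-- The doubly robust exploitability estimator:
`max_{π₁ ∈ Pi₁} v̂_1(π₁, πe₂) + max_{π₂ ∈ Pi₂} v̂_2(πe₁, π₂)`. -/
def drExploitability {n : ℕ} (γ : ℝ) (e : Procedure S A₁ A₂ T K n)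
    (Pi₁ : Set (Policy S A₁ T)) (Pi₂ : Set (Policy S A₂ T)) (πe : Profile S A₁ A₂ T)
    (ω : Sample S A₁ A₂ T K n) : ℝ :=
  sSup ((fun π₁ => drValue γ e ω (π₁, πe.2)) '' Pi₁) +
    sSup ((fun π₂ => -drValue γ e ω (πe.1, π₂)) '' Pi₂)

end CrossFitting

section Covering

variable {S A₁ A₂ : Type*} [Fintype A₁] [Fintype A₂] {T : ℕ}

open Classical in
/-- Hamming distance of two profiles on `m` state trajectories: the fraction of the trajectories
along which a policy of the first profile differs from that of the second one. -/
def hammingDistance {m : ℕ} (x : Fin m → Fin T → S) (π π' : Profile S A₁ A₂ T) : ℝ :=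
  ((Finset.univ.filter fun i : Fin m =>
    (∃ t, π.1 t (x i t) ≠ π'.1 t (x i t)) ∨ (∃ t, π.2 t (x i t) ≠ π'.2 t (x i t))).card : ℝ) / m

/-- The smallest number of profiles of `Pi` that `ε`-cover `Pi` on the given state trajectories. -/
def coveringNumberOn {m : ℕ} (ε : ℝ) (Pi : Set (Profile S A₁ A₂ T))
    (x : Fin m → Fin T → S) : ℕ∞ :=
  ⨅ (F : Finset (Profile S A₁ A₂ T)) (_ : (F : Set (Profile S A₁ A₂ T)) ⊆ Pi ∧
    ∀ π ∈ Pi, ∃ π' ∈ F, hammingDistance x π π' ≤ ε), (F.card : ℕ∞)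

/-- The `ε`-Hamming covering number of the class `Pi`. -/
def coveringNumber (ε : ℝ) (Pi : Set (Profile S A₁ A₂ T)) : ℕ∞ :=
  ⨆ (m : ℕ) (_ : 1 ≤ m) (x : Fin m → Fin T → S), coveringNumberOn ε Pi x

/-- The entropy integral `∫_0^∞ √(log N_H(ε², Pi)) dε`. -/
def entropyIntegral (Pi : Set (Profile S A₁ A₂ T)) : ℝ :=
  ∫ ε in Set.Ioi (0 : ℝ), √(Real.log ((coveringNumber (ε ^ 2) Pi).toNat : ℝ))

end Covering

end ZeroSumOPE

end

/-!
The error of the doubly robust exploitability estimator is at most the sum of two uniform errors of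
the value estimator, one over the profiles `(π₁, πe₂)` and one over the profiles `(πe₁, π₂)`
(`Game.abs_classExploitability_sub_le`). Because the state space is finite, the covering hypothesis
makes the class finite: on the constant state trajectories, one per state, distinct profiles are at
Hamming distance at least `1 / |S|`, so a finite cover of smaller radius contains the whole class
(`finite_of_coveringNumber_ne_top`). A union bound over the profiles and the folds therefore
replaces chaining. Its logarithmic cost is a constant multiple of `log (1 / δ)`, because only
`δ < 1 / 2` matters; the nonnegative entropy integral is then added for free, and `Υ*`, which is
positive and does not depend on `n` or `δ`, is absorbed by the constant.

For one profile, the error splits into deviations and biases, fold by fold.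

* *Deviations.* Given the folds and the observations outside a fold, the fitted score is a fixed
  bounded function of the independent trajectories of that fold, so Hoeffding's inequality applies
  conditionally (`measure_splitDeviation_ge_le`, `Game.measure_foldDeviation_ge_le`). Boundedness of
  the fits suffices here; their consistency plays no role.

* *Biases.* By the Bellman equation and a one-step change of measure, both consequences of the Markov
  property of the path law (`Game.sum_pathWeight_eq_average`), the mean of the score with arbitrary
  nuisances differs from the true value by a sum of products of an error in the density ratios with
  an error in the state-action values (`Game.integral_drScore_sub_value`). The former is bounded by
  the error of the inverse behavior probabilities (`abs_partialRatio_sub_le`), the latter by the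
  errors of the products of transition probabilities and mean rewards along paths
  (`abs_qValue_sub_le`). There are finitely many paths, so Markov's inequality turns the mean square
  rates into the bounds `n ^ (-α₁)` and `n ^ (-α₂)` along every path that the behavior profile can
  generate, with probability tending to one (`Game.tendsto_measure_not_nuisanceErrorLE`). The biases
  are then of order `n ^ (-(α₁ + α₂)) ≤ n ^ (-1/2)`.
-/

set_option linter.unusedSectionVars false

namespace ZeroSumOPE

/-! ### Paths and the resampling of one step -/

/-- The discrete part of a trajectory: its states and its actions. -/
abbrev Path (S A₁ A₂ : Type*) (T : ℕ) : Type _ :=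
  (Fin (T + 1) → S) × (Fin T → A₁) × (Fin T → A₂)

section Paths

variable {S A₁ A₂ : Type*} {T : ℕ}

/-- The trajectory with discrete part `p` and rewards `r`. -/
def Path.traj (p : Path S A₁ A₂ T) (r : Fin T → ℝ) : Traj S A₁ A₂ T := (p.1, p.2.1, p.2.2, r)

/-- The discrete part of a trajectory. -/
def Traj.path (τ : Traj S A₁ A₂ T) : Path S A₁ A₂ T := (τ.1, τ.2.1, τ.2.2.1)

/-- The outcome of step `t`: the two actions and the state that follows them. -/
def Path.outcome (p : Path S A₁ A₂ T) (t : Fin T) : A₁ × A₂ × S :=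
  (p.2.1 t, p.2.2 t, p.1 t.succ)

/-- The path `p` with the outcome of step `t` replaced by `y`; all later outcomes are kept. -/
def Path.setOutcome (p : Path S A₁ A₂ T) (t : Fin T) (y : A₁ × A₂ × S) : Path S A₁ A₂ T :=
  (Function.update p.1 t.succ y.2.2, Function.update p.2.1 t y.1, Function.update p.2.2 t y.2.1)

/-- `F` depends only on the initial state and on the outcomes of the first `t` steps. -/
def IsPrefixFunction (t : ℕ) (F : Path S A₁ A₂ T → ℝ) : Prop :=
  ∀ l : Fin T, t ≤ l → ∀ p y, F (p.setOutcome l y) = F p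

lemma Path.setOutcome_fst_castSucc (p : Path S A₁ A₂ T) {t l : Fin T} (h : l ≤ t)
    (y : A₁ × A₂ × S) : (p.setOutcome t y).1 l.castSucc = p.1 l.castSucc := by
  apply Function.update_of_ne
  intro h'
  have := congrArg Fin.val h'
  simp only [Fin.val_castSucc, Fin.val_succ] at this
  have : (l : ℕ) ≤ t := h
  omega

lemma Path.setOutcome_fst_zero (p : Path S A₁ A₂ T) (t : Fin T)
    (y : A₁ × A₂ × S) : (p.setOutcome t y).1 0 = p.1 0 := by
  simp [Path.setOutcome, (Fin.succ_ne_zero t).symm]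

lemma Path.setOutcome_fst_succ (p : Path S A₁ A₂ T) {t l : Fin T} (h : l < t)
    (y : A₁ × A₂ × S) : (p.setOutcome t y).1 l.succ = p.1 l.succ :=
  by
  apply Function.update_of_ne
  exact fun h' => h.ne (Fin.succ_injective _ h')

lemma Path.setOutcome_act₁ (p : Path S A₁ A₂ T) {t l : Fin T} (h : l < t)
    (y : A₁ × A₂ × S) : (p.setOutcome t y).2.1 l = p.2.1 l :=
  Function.update_of_ne h.ne _ _

lemma Path.setOutcome_act₂ (p : Path S A₁ A₂ T) {t l : Fin T} (h : l < t)
    (y : A₁ × A₂ × S) : (p.setOutcome t y).2.2 l = p.2.2 l :=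
  Function.update_of_ne h.ne _ _

@[simp] lemma Path.setOutcome_fst_succ_self (p : Path S A₁ A₂ T) (t : Fin T)
    (y : A₁ × A₂ × S) : (p.setOutcome t y).1 t.succ = y.2.2 := Function.update_self ..

@[simp] lemma Path.setOutcome_act₁_self (p : Path S A₁ A₂ T) (t : Fin T)
    (y : A₁ × A₂ × S) : (p.setOutcome t y).2.1 t = y.1 := Function.update_self ..

@[simp] lemma Path.setOutcome_act₂_self (p : Path S A₁ A₂ T) (t : Fin T)
    (y : A₁ × A₂ × S) : (p.setOutcome t y).2.2 t = y.2.1 := Function.update_self ..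

lemma Path.setOutcome_setOutcome_comm (p : Path S A₁ A₂ T) {t l : Fin T} (h : l ≠ t)
    (y z : A₁ × A₂ × S) :
    (p.setOutcome t y).setOutcome l z = (p.setOutcome l z).setOutcome t y := by
  unfold Path.setOutcome
  refine Prod.ext ?_ (Prod.ext ?_ ?_)
  · exact Function.update_comm (fun h' => h.symm (Fin.succ_injective _ h')) _ _ _
  · exact Function.update_comm h.symm _ _ _
  · exact Function.update_comm h.symm _ _ _

lemma IsPrefixFunction.mono {s t : ℕ} (hst : s ≤ t) {F : Path S A₁ A₂ T → ℝ}
    (hF : IsPrefixFunction s F) : IsPrefixFunction t F :=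
  fun l hl p y => hF l (hst.trans hl) p y

lemma IsPrefixFunction.mul {t : ℕ} {F F' : Path S A₁ A₂ T → ℝ} (hF : IsPrefixFunction t F)
    (hF' : IsPrefixFunction t F') : IsPrefixFunction t fun p => F p * F' p :=
  fun l hl p y => by simp only [hF l hl p y, hF' l hl p y]

/-- A function of the state and of the outcome of step `t` is determined by the first `t + 1`
steps. -/
lemma isPrefixFunction_step (t : Fin T) (g : S → A₁ → A₂ → S → ℝ) :
    IsPrefixFunction (t + 1) fun p : Path S A₁ A₂ T =>
      g (p.1 t.castSucc) (p.2.1 t) (p.2.2 t) (p.1 t.succ) := by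
  intro l hl p y
  have h : t < l := Fin.lt_def.2 (by omega)
  simp only [p.setOutcome_fst_castSucc h.le, p.setOutcome_act₁ h, p.setOutcome_act₂ h,
    p.setOutcome_fst_succ h]

variable [Fintype S] [Fintype A₁] [Fintype A₂]

/-- Summing over all outcomes of one step counts every path once for each outcome. -/
lemma sum_setOutcome (t : Fin T) (F : Path S A₁ A₂ T → ℝ) :
    ∑ p, ∑ y, F (Path.setOutcome p t y) = Fintype.card (A₁ × A₂ × S) * ∑ p, F p := by
  have hinv : Function.Involutive fun q : Path S A₁ A₂ T × (A₁ × A₂ × S) =>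
      (q.1.setOutcome t q.2, q.1.outcome t) := by
    rintro ⟨p, y⟩
    simp [Path.setOutcome, Path.outcome]
  have h := Fintype.sum_equiv hinv.toPerm
    (fun q : Path S A₁ A₂ T × (A₁ × A₂ × S) => F (q.1.setOutcome t q.2)) (fun q => F q.1)
    (fun q => rfl)
  rw [Fintype.sum_prod_type, Fintype.sum_prod_type (f := fun q => F q.1)] at h
  rw [h]
  simp [Finset.mul_sum]

end Paths

/-! ### The law of a path -/

section PathLaw

variable {S A₁ A₂ : Type*} [Fintype S] [Fintype A₁] [Fintype A₂] {T : ℕ}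

/-- The probability of the outcome `(a₁, a₂, s')` of step `t` from the state `s`. -/
def Game.stepProb (G : Game S A₁ A₂) (π : Profile S A₁ A₂ T) (t : Fin T)
    (s : S) (a₁ : A₁) (a₂ : A₂) (s' : S) : ℝ :=
  π.1 t s a₁ * π.2 t s a₂ * G.trans s a₁ a₂ s'

/-- The probability that the first `t` steps are those of the path `p`. -/
def Game.prefixWeight (G : Game S A₁ A₂) (π : Profile S A₁ A₂ T) (t : ℕ)
    (p : Path S A₁ A₂ T) : ℝ :=
  G.init (p.1 0) * ∏ l ∈ Finset.univ.filter fun l : Fin T => (l : ℕ) < t,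
    G.stepProb π l (p.1 l.castSucc) (p.2.1 l) (p.2.2 l) (p.1 l.succ)

/-- The probability of the path `p`. -/
def Game.pathWeight (G : Game S A₁ A₂) (π : Profile S A₁ A₂ T) (p : Path S A₁ A₂ T) : ℝ :=
  G.init (p.1 0) * ∏ l : Fin T, G.stepProb π l (p.1 l.castSucc) (p.2.1 l) (p.2.2 l) (p.1 l.succ)

variable (G : Game S A₁ A₂) (π : Profile S A₁ A₂ T)

lemma Game.stepProb_nonneg (t : Fin T) (s : S) (a₁ : A₁) (a₂ : A₂) (s' : S) :
    0 ≤ G.stepProb π t s a₁ a₂ s' :=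
  mul_nonneg (mul_nonneg ((π.1 t s).2.1 _) ((π.2 t s).2.1 _)) ((G.trans s a₁ a₂).2.1 _)

lemma Game.pathWeight_nonneg (p : Path S A₁ A₂ T) : 0 ≤ G.pathWeight π p :=
  mul_nonneg (G.init.2.1 _) (Finset.prod_nonneg fun _ _ => G.stepProb_nonneg π _ _ _ _ _)

lemma Game.sum_trans (s : S) (a₁ : A₁) (a₂ : A₂) : ∑ s', G.trans s a₁ a₂ s' = 1 :=
  (G.trans s a₁ a₂).2.2

lemma Policy.sum_eq_one {A : Type*} [Fintype A] (ρ : Policy S A T) (t : Fin T) (s : S) :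
    ∑ a, ρ t s a = 1 :=
  (ρ t s).2.2

lemma Profile.sum_eq_one (t : Fin T) (s : S) : ∑ a₁, ∑ a₂, π.1 t s a₁ * π.2 t s a₂ = 1 := by
  simp only [← Finset.mul_sum, Policy.sum_eq_one, mul_one]

/-- Averaging over the outcome of a step a function of the actions alone. -/
lemma Game.sum_stepProb_mul (t : Fin T) (s : S) (g : A₁ → A₂ → ℝ) :
    ∑ y : A₁ × A₂ × S, G.stepProb π t s y.1 y.2.1 y.2.2 * g y.1 y.2.1 =
      ∑ a₁, ∑ a₂, π.1 t s a₁ * π.2 t s a₂ * g a₁ a₂ := by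
  simp only [Fintype.sum_prod_type, Game.stepProb, ← Finset.sum_mul, ← Finset.mul_sum,
    G.sum_trans, mul_one]

lemma Game.sum_stepProb (t : Fin T) (s : S) :
    ∑ y : A₁ × A₂ × S, G.stepProb π t s y.1 y.2.1 y.2.2 = 1 := by
  simpa [Profile.sum_eq_one] using G.sum_stepProb_mul π t s fun _ _ => 1

lemma Game.prefixWeight_setOutcome (t : Fin T) (p : Path S A₁ A₂ T) (y : A₁ × A₂ × S) :
    G.prefixWeight π (t + 1) (p.setOutcome t y) =
      G.prefixWeight π t p * G.stepProb π t (p.1 t.castSucc) y.1 y.2.1 y.2.2 := by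
  have hset : (Finset.univ.filter fun l : Fin T => (l : ℕ) < t + 1) =
      insert t (Finset.univ.filter fun l : Fin T => (l : ℕ) < t) := by
    ext l
    simp only [Finset.mem_filter, Finset.mem_univ, true_and, Finset.mem_insert, Fin.ext_iff]
    omega
  unfold Game.prefixWeight
  rw [hset, Finset.prod_insert (by simp), p.setOutcome_fst_zero, p.setOutcome_fst_castSucc le_rfl]
  have : ∀ l ∈ Finset.univ.filter (fun l : Fin T => (l : ℕ) < t),
      G.stepProb π l ((p.setOutcome t y).1 l.castSucc) ((p.setOutcome t y).2.1 l)
        ((p.setOutcome t y).2.2 l) ((p.setOutcome t y).1 l.succ) =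
      G.stepProb π l (p.1 l.castSucc) (p.2.1 l) (p.2.2 l) (p.1 l.succ) := by
    intro l hl
    have hl : l < t := Fin.lt_def.2 (Finset.mem_filter.1 hl).2
    rw [p.setOutcome_fst_castSucc hl.le, p.setOutcome_act₁ hl, p.setOutcome_act₂ hl,
      p.setOutcome_fst_succ hl]
  rw [Finset.prod_congr rfl this]
  simp only [Path.setOutcome_act₁_self, Path.setOutcome_act₂_self, Path.setOutcome_fst_succ_self]
  ring

lemma Game.prefixWeight_self (p : Path S A₁ A₂ T) : G.prefixWeight π T p = G.pathWeight π p := by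
  simp [Game.prefixWeight, Game.pathWeight]

/-- The Markov property at step `t`, for prefix weights. -/
lemma Game.card_mul_sum_prefixWeight (t : Fin T) (F : Path S A₁ A₂ T → ℝ) :
    Fintype.card (A₁ × A₂ × S) * ∑ p, G.prefixWeight π (t + 1) p * F p =
      ∑ p, G.prefixWeight π t p *
        ∑ y : A₁ × A₂ × S, G.stepProb π t (p.1 t.castSucc) y.1 y.2.1 y.2.2 *
          F (p.setOutcome t y) := by
  rw [← sum_setOutcome t]
  refine Finset.sum_congr rfl fun p _ => ?_
  rw [Finset.mul_sum]
  refine Finset.sum_congr rfl fun y _ => ?_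
  rw [G.prefixWeight_setOutcome, mul_assoc]

/-- The steps that a function does not depend on can be summed out. -/
lemma Game.card_pow_mul_sum_pathWeight (t : ℕ) (ht : t ≤ T) (F : Path S A₁ A₂ T → ℝ)
    (hF : IsPrefixFunction t F) :
    (Fintype.card (A₁ × A₂ × S) : ℝ) ^ (T - t) * ∑ p, G.pathWeight π p * F p =
      ∑ p, G.prefixWeight π t p * F p := by
  induction ht using Nat.decreasingInduction with
  | self => simp [Game.prefixWeight_self]
  | of_succ k hk ih =>
    have h := G.card_mul_sum_prefixWeight π ⟨k, hk⟩ F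
    rw [← ih (hF.mono (Nat.le_succ k))] at h
    have e : T - k = T - (k + 1) + 1 := by omega
    rw [e, pow_succ', mul_assoc, h]
    refine Finset.sum_congr rfl fun p _ => ?_
    simp only [hF ⟨k, hk⟩ le_rfl]
    rw [← Finset.sum_mul, G.sum_stepProb, one_mul]

include G in
lemma Game.nonempty_state : Nonempty S := by
  by_contra h
  rw [not_nonempty_iff] at h
  simpa using G.init.2.2

include G π in
lemma Game.card_outcome_ne_zero (t : Fin T) : (Fintype.card (A₁ × A₂ × S) : ℝ) ≠ 0 := by
  obtain ⟨s⟩ := G.nonempty_state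
  have h₁ : Nonempty A₁ := by
    by_contra h
    rw [not_nonempty_iff] at h
    simpa using (π.1 t s).2.2
  have h₂ : Nonempty A₂ := by
    by_contra h
    rw [not_nonempty_iff] at h
    simpa using (π.2 t s).2.2
  have : Nonempty S := ⟨s⟩
  exact_mod_cast Fintype.card_ne_zero

/-- The Markov property: the outcome of step `t` can be averaged given the past. -/
lemma Game.sum_pathWeight_eq_average (t : Fin T) (F : Path S A₁ A₂ T → ℝ)
    (hF : IsPrefixFunction (t + 1) F) :
    ∑ p, G.pathWeight π p * F p =
      ∑ p, G.pathWeight π p *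
        ∑ y : A₁ × A₂ × S, G.stepProb π t (p.1 t.castSucc) y.1 y.2.1 y.2.2 *
          F (p.setOutcome t y) := by
  have hc := G.card_outcome_ne_zero π t
  refine mul_left_cancel₀ (pow_ne_zero (T - t) hc) ?_
  rw [G.card_pow_mul_sum_pathWeight π t t.2.le (fun p => ∑ y : A₁ × A₂ × S,
    G.stepProb π t (p.1 t.castSucc) y.1 y.2.1 y.2.2 * F (p.setOutcome t y))]
  · rw [← G.card_mul_sum_prefixWeight, ← G.card_pow_mul_sum_pathWeight π (t + 1) t.2 F hF,
      ← mul_assoc, ← pow_succ']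
    congr 2
    have := t.2
    omega
  · intro l hl p y
    have hl' : t ≤ l := Fin.le_def.2 hl
    simp only [p.setOutcome_fst_castSucc hl']
    refine Finset.sum_congr rfl fun z _ => ?_
    rcases eq_or_ne l t with rfl | hne
    · congr 2
      simp [Path.setOutcome]
    · rw [p.setOutcome_setOutcome_comm hne.symm,
        hF l (Nat.succ_le_of_lt (Fin.lt_def.1 (lt_of_le_of_ne hl' hne.symm)))]

/-- The initial state has law `G.init`, whatever the profile. -/
lemma Game.sum_pathWeight_initial (g : S → ℝ) :
    ∑ p, G.pathWeight π p * g (p.1 0) = ∑ s, G.init s * g s := by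
  have h := G.card_pow_mul_sum_pathWeight π 0 (Nat.zero_le T) (fun p => g (p.1 0))
    (fun l _ p y => by simp only [p.setOutcome_fst_zero])
  have h2 : ∑ p : Path S A₁ A₂ T, G.prefixWeight π 0 p * g (p.1 0) =
      (Fintype.card (A₁ × A₂ × S) : ℝ) ^ T * ∑ s, G.init s * g s := by
    simp only [Game.prefixWeight, not_lt_zero, Finset.filter_false, Finset.prod_empty, mul_one,
      Fintype.sum_prod_type, Finset.sum_const, nsmul_eq_mul]
    rw [← Fintype.sum_equiv (Fin.consEquiv fun _ => S)
      (fun q => (Finset.univ : Finset (Fin T → A₁)).card *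
        ((Finset.univ : Finset (Fin T → A₂)).card * (G.init q.1 * g q.1))) _ (fun q => by simp [mul_assoc])]
    simp only [Fintype.sum_prod_type, Finset.sum_const, Finset.mul_sum, Finset.card_univ,
      Fintype.card_pi, Fintype.card_prod, Finset.prod_const, nsmul_eq_mul, Fintype.card_fin]
    refine Finset.sum_congr rfl fun s _ => ?_
    push_cast
    ring
  rw [h2, Nat.sub_zero] at h
  rcases Nat.eq_zero_or_pos T with rfl | hT
  · simpa using h
  · exact mul_left_cancel₀ (pow_ne_zero T (G.card_outcome_ne_zero π ⟨0, hT⟩)) h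

lemma Game.sum_pathWeight : ∑ p, G.pathWeight π p = 1 := by
  have h : ∑ s, G.init s = 1 := G.init.2.2
  simpa [h] using G.sum_pathWeight_initial π fun _ => 1

end PathLaw

/-! ### Integrals against the law of a trajectory -/

section Integrals

variable {S A₁ A₂ : Type*} [Fintype S] [Fintype A₁] [Fintype A₂]
  [MeasurableSpace S] [MeasurableSpace A₁] [MeasurableSpace A₂] {T : ℕ}
  (G : Game S A₁ A₂) (π : Profile S A₁ A₂ T)

/-- The law of the rewards along a path. -/
noncomputable def Game.rewardLaw (p : Path S A₁ A₂ T) : Measure (Fin T → ℝ) :=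
  Measure.pi fun t => (G.reward (p.1 t.castSucc) (p.2.1 t) (p.2.2 t) : Measure ℝ)

instance (p : Path S A₁ A₂ T) : IsProbabilityMeasure (G.rewardLaw p) := by
  unfold Game.rewardLaw; infer_instance

lemma Path.measurable_traj (p : Path S A₁ A₂ T) : Measurable p.traj := by
  unfold Path.traj; fun_prop

lemma Game.law_eq_sum : G.law π =
    ∑ p, ENNReal.ofReal (G.pathWeight π p) • Measure.map p.traj (G.rewardLaw p) := by
  simp only [Fintype.sum_prod_type]
  rfl

instance Game.isProbabilityMeasure_law : IsProbabilityMeasure (G.law π) := by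
  constructor
  rw [G.law_eq_sum, Measure.finsetSum_apply]
  have : ∀ p : Path S A₁ A₂ T, Measure.map p.traj (G.rewardLaw p) Set.univ = 1 := fun p => by
    rw [Measure.map_apply p.measurable_traj .univ]; simp
  simp only [Measure.smul_apply, this, smul_eq_mul, mul_one]
  rw [← ENNReal.ofReal_sum_of_nonneg fun p _ => G.pathWeight_nonneg π p, G.sum_pathWeight]
  simp

/-- A property of the rewards that holds almost surely along every path of positive probability
holds almost surely for trajectories. -/
lemma Game.ae_law {P : Traj S A₁ A₂ T → Prop}
    (h : ∀ p, 0 < G.pathWeight π p → ∀ᵐ τ ∂(Measure.map p.traj (G.rewardLaw p)), P τ) :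
    ∀ᵐ τ ∂(G.law π), P τ := by
  rw [G.law_eq_sum, ae_iff, Measure.finsetSum_apply]
  refine Finset.sum_eq_zero fun p _ => ?_
  rcases (G.pathWeight_nonneg π p).eq_or_lt with h0 | h0
  · simp [← h0]
  · simp [ae_iff.1 (h p h0)]

lemma Game.lintegral_law {F : Traj S A₁ A₂ T → ENNReal} {F' : Path S A₁ A₂ T → ENNReal}
    (hF : Measurable F) (h : ∀ p r, F (p.traj r) = F' p) :
    ∫⁻ τ, F τ ∂(G.law π) = ∑ p, ENNReal.ofReal (G.pathWeight π p) * F' p := by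
  rw [G.law_eq_sum, lintegral_finsetSum_measure]
  refine Finset.sum_congr rfl fun p _ => ?_
  rw [lintegral_smul_measure, lintegral_map hF p.measurable_traj]
  simp [h]

lemma Game.measurePreserving_reward (p : Path S A₁ A₂ T) (t : Fin T) :
    MeasurePreserving (fun r : Fin T → ℝ => r t) (G.rewardLaw p)
      (G.reward (p.1 t.castSucc) (p.2.1 t) (p.2.2 t) : Measure ℝ) :=
  measurePreserving_eval (fun t : Fin T =>
    (G.reward (p.1 t.castSucc) (p.2.1 t) (p.2.2 t) : Measure ℝ)) t

variable {Rmax : ℝ} (hReward : ∀ s a₁ a₂, ∀ᵐ r ∂(G.reward s a₁ a₂ : Measure ℝ), |r| ≤ Rmax)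

include hReward in
lemma Game.ae_rewardLaw (p : Path S A₁ A₂ T) :
    ∀ᵐ r ∂(G.rewardLaw p), ∀ t, |r t| ≤ Rmax :=
  ae_all_iff.2 fun t => (G.measurePreserving_reward p t).quasiMeasurePreserving.ae (hReward _ _ _)

include hReward in
lemma Game.ae_law_rew [MeasurableSingletonClass S] [MeasurableSingletonClass A₁]
    [MeasurableSingletonClass A₂] : ∀ᵐ τ ∂(G.law π), ∀ t, |τ.rew t| ≤ Rmax := by
  refine G.ae_law π fun p _ => ?_
  rw [ae_map_iff p.measurable_traj.aemeasurable]
  · exact G.ae_rewardLaw hReward p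
  · have : Measurable fun τ : Traj S A₁ A₂ T => τ.2.2.2 := by fun_prop
    simp only [Set.ofPred_forall, Traj.rew]
    exact MeasurableSet.iInter fun t => measurableSet_le (by fun_prop) measurable_const

include hReward in
lemma Game.integrable_reward (p : Path S A₁ A₂ T) (t : Fin T) :
    Integrable (fun r : Fin T → ℝ => r t) (G.rewardLaw p) :=
  Integrable.of_bound (measurable_pi_apply t).aestronglyMeasurable Rmax
    ((G.ae_rewardLaw hReward p).mono fun _ hr => hr t)

include hReward in
/-- The expectation of a function of the trajectory that is affine in the rewards, with
coefficients that depend on the path. -/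
lemma Game.integral_law {F : Traj S A₁ A₂ T → ℝ} {c d : Fin T → Path S A₁ A₂ T → ℝ}
    (hF : Measurable F)
    (h : ∀ p r, F (Path.traj p r) = ∑ t, (c t p * r t + d t p)) :
    ∫ τ, F τ ∂(G.law π) = ∑ p : Path S A₁ A₂ T, G.pathWeight π p *
      ∑ t, (c t p * G.meanReward (p.1 t.castSucc) (p.2.1 t) (p.2.2 t) + d t p) := by
  have hint : ∀ (p : Path S A₁ A₂ T), ∀ t ∈ Finset.univ,
      Integrable (fun r : Fin T → ℝ => c t p * r t + d t p) (G.rewardLaw p) := fun p t _ =>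
    ((G.integrable_reward hReward p t).const_mul _).add (integrable_const _)
  rw [G.law_eq_sum, integral_finsetSum_measure]
  · refine Finset.sum_congr rfl fun p _ => ?_
    rw [integral_smul_measure, ENNReal.toReal_ofReal (G.pathWeight_nonneg π p),
      integral_map p.measurable_traj.aemeasurable hF.aestronglyMeasurable, smul_eq_mul]
    simp only [h]
    rw [integral_finsetSum _ (hint p)]
    congr 1
    refine Finset.sum_congr rfl fun t _ => ?_
    rw [integral_add ((G.integrable_reward hReward p t).const_mul _) (integrable_const _),
      integral_const_mul]
    congr 2
    · have hmp := G.measurePreserving_reward p t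
      rw [Game.meanReward, ← hmp.map_eq, integral_map hmp.measurable.aemeasurable
        (by fun_prop)]
    · simp
  · intro p _
    refine Integrable.smul_measure ?_ ENNReal.ofReal_ne_top
    rw [integrable_map_measure hF.aestronglyMeasurable p.measurable_traj.aemeasurable]
    have : F ∘ p.traj = fun r => ∑ t, (c t p * r t + d t p) := funext fun r => h p r
    rw [this]
    exact integrable_finsetSum _ (hint p)

end Integrals

/-! ### Value functions and density ratios -/

section Bellman

variable {S A₁ A₂ : Type*} [Fintype S] [Fintype A₁] [Fintype A₂] {T : ℕ}

lemma stateValue_last (γ : ℝ) (N : Nuisance S A₁ A₂ T) (π : Profile S A₁ A₂ T) (s : S) :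
    stateValue γ N π (Fin.last T) s = 0 := by
  simp [stateValue]

lemma stateValue_castSucc (γ : ℝ) (N : Nuisance S A₁ A₂ T) (π : Profile S A₁ A₂ T) (t : Fin T)
    (s : S) : stateValue γ N π t.castSucc s =
      ∑ a₁, ∑ a₂, π.1 t s a₁ * π.2 t s a₂ * qValue γ N π t s a₁ a₂ := by
  simp only [stateValue, qValue, Fin.reverseInduction_castSucc]

/-- A mean over the actions lies within the bounds of the averaged function. -/
lemma Profile.abs_sum_le (π : Profile S A₁ A₂ T) (t : Fin T) (s : S) {g : A₁ → A₂ → ℝ} {M : ℝ}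
    (hg : ∀ a₁ a₂, |g a₁ a₂| ≤ M) :
    |∑ a₁, ∑ a₂, π.1 t s a₁ * π.2 t s a₂ * g a₁ a₂| ≤ M := by
  have h0 : ∀ a₁ a₂, 0 ≤ π.1 t s a₁ * π.2 t s a₂ := fun a₁ a₂ =>
    mul_nonneg ((π.1 t s).2.1 _) ((π.2 t s).2.1 _)
  calc |∑ a₁, ∑ a₂, π.1 t s a₁ * π.2 t s a₂ * g a₁ a₂|
      ≤ ∑ a₁, ∑ a₂, π.1 t s a₁ * π.2 t s a₂ * M := by
        refine (Finset.abs_sum_le_sum_abs _ _).trans (Finset.sum_le_sum fun a₁ _ => ?_)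
        refine (Finset.abs_sum_le_sum_abs _ _).trans (Finset.sum_le_sum fun a₂ _ => ?_)
        rw [abs_mul, abs_of_nonneg (h0 a₁ a₂)]
        exact mul_le_mul_of_nonneg_left (hg a₁ a₂) (h0 a₁ a₂)
    _ = M := by simp only [← Finset.sum_mul, π.sum_eq_one, one_mul]

/-- The product of the density ratios of the first `j` steps. -/
noncomputable def partialRatio (N : Nuisance S A₁ A₂ T) (π : Profile S A₁ A₂ T) (j : ℕ)
    (p : Path S A₁ A₂ T) : ℝ :=
  ∏ l ∈ Finset.univ.filter fun l : Fin T => (l : ℕ) < j, ratio N π (p.traj 0) l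

lemma cumRatio_traj (N : Nuisance S A₁ A₂ T) (π : Profile S A₁ A₂ T) (p : Path S A₁ A₂ T)
    (r : Fin T → ℝ) (t : Fin T) : cumRatio N π (p.traj r) t = partialRatio N π (t + 1) p := by
  have : Finset.Iic t = Finset.univ.filter fun l : Fin T => (l : ℕ) < t + 1 := by
    ext l
    simp only [Finset.mem_Iic, Finset.mem_filter, Finset.mem_univ, true_and, Fin.le_def]
    omega
  rw [cumRatio, this]
  rfl

lemma prevCumRatio_traj (N : Nuisance S A₁ A₂ T) (π : Profile S A₁ A₂ T) (p : Path S A₁ A₂ T)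
    (r : Fin T → ℝ) (t : Fin T) : prevCumRatio N π (p.traj r) t = partialRatio N π t p := by
  have : Finset.Iio t = Finset.univ.filter fun l : Fin T => (l : ℕ) < t := by
    ext l
    simp only [Finset.mem_Iio, Finset.mem_filter, Finset.mem_univ, true_and, Fin.lt_def]
  rw [prevCumRatio, this]
  rfl

@[simp] lemma partialRatio_zero (N : Nuisance S A₁ A₂ T) (π : Profile S A₁ A₂ T)
    (p : Path S A₁ A₂ T) : partialRatio N π 0 p = 1 := by
  simp [partialRatio]

lemma partialRatio_succ (N : Nuisance S A₁ A₂ T) (π : Profile S A₁ A₂ T) (p : Path S A₁ A₂ T)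
    (t : Fin T) : partialRatio N π (t + 1) p = partialRatio N π t p * ratio N π (p.traj 0) t := by
  have hset : (Finset.univ.filter fun l : Fin T => (l : ℕ) < t + 1) =
      insert t (Finset.univ.filter fun l : Fin T => (l : ℕ) < t) := by
    ext l
    simp only [Finset.mem_filter, Finset.mem_univ, true_and, Finset.mem_insert, Fin.ext_iff]
    omega
  rw [partialRatio, hset, Finset.prod_insert (by simp), mul_comm]
  rfl

lemma isPrefixFunction_ratio (N : Nuisance S A₁ A₂ T) (π : Profile S A₁ A₂ T) (t : Fin T) :
    IsPrefixFunction (t + 1) fun p => ratio N π (p.traj 0) t :=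
  isPrefixFunction_step t fun s a₁ a₂ _ => π.1 t s a₁ * π.2 t s a₂ / (N.b₁ t s a₁ * N.b₂ t s a₂)

lemma isPrefixFunction_partialRatio (N : Nuisance S A₁ A₂ T) (π : Profile S A₁ A₂ T) (j : ℕ) :
    IsPrefixFunction j (partialRatio N π j) := by
  intro l hl p y
  refine Finset.prod_congr rfl fun m hm => isPrefixFunction_ratio N π m l ?_ p y
  have := (Finset.mem_filter.1 hm).2
  omega

/-- `h` depends on the outcome of step `t` only through the actions. -/
def IgnoresNextState (t : Fin T) (h : Path S A₁ A₂ T → ℝ) : Prop :=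
  ∀ (p : Path S A₁ A₂ T) a₁ a₂ s s', h (p.setOutcome t (a₁, a₂, s)) = h (p.setOutcome t (a₁, a₂, s'))

lemma ignoresNextState_partialRatio (N : Nuisance S A₁ A₂ T) (π : Profile S A₁ A₂ T)
    (t : Fin T) : IgnoresNextState t (partialRatio N π (t + 1)) := by
  intro p a₁ a₂ s s'
  rw [partialRatio_succ, partialRatio_succ, isPrefixFunction_partialRatio N π t t le_rfl,
    isPrefixFunction_partialRatio N π t t le_rfl]
  congr 1
  simp [ratio, Path.traj, Traj.st, Traj.act₁, Traj.act₂, p.setOutcome_fst_castSucc le_rfl]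

variable (G : Game S A₁ A₂)

/-- The Bellman equation as a martingale property: whatever the behavior profile `β` is, the
temporal difference `r_t + γ V_{t+1}(s_{t+1}) - Q_t(s_t, a_t)` of the true value functions has mean
zero given the past and the actions of step `t`. -/
lemma Game.sum_pathWeight_temporalDifference (β β' π : Profile S A₁ A₂ T) (t : Fin T)
    (h : Path S A₁ A₂ T → ℝ) (hh : IsPrefixFunction (t + 1) h) (hh' : IgnoresNextState t h) :
    ∑ p, G.pathWeight β p * (h p * (G.meanReward (p.1 t.castSucc) (p.2.1 t) (p.2.2 t) +
      G.γ * stateValue G.γ (G.nuisance β') π t.succ (p.1 t.succ) -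
      qValue G.γ (G.nuisance β') π t (p.1 t.castSucc) (p.2.1 t) (p.2.2 t))) = 0 := by
  set V := stateValue G.γ (G.nuisance β') π t.succ with hV
  set Q := qValue G.γ (G.nuisance β') π t with hQ
  rw [G.sum_pathWeight_eq_average β t _ (hh.mul (isPrefixFunction_step t
    fun s a₁ a₂ s' => G.meanReward s a₁ a₂ + G.γ * V s' - Q s a₁ a₂))]
  refine Finset.sum_eq_zero fun p _ => mul_eq_zero_of_right _ ?_
  simp only [Fintype.sum_prod_type, p.setOutcome_fst_castSucc le_rfl, Path.setOutcome_act₁_self,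
    Path.setOutcome_act₂_self, Path.setOutcome_fst_succ_self]
  refine Finset.sum_eq_zero fun a₁ _ => Finset.sum_eq_zero fun a₂ _ => ?_
  set s := p.1 t.castSucc
  have hq : Q s a₁ a₂ = G.meanReward s a₁ a₂ + G.γ * ∑ s', G.trans s a₁ a₂ s' * V s' := rfl
  calc ∑ s', G.stepProb β t s a₁ a₂ s' * (h (p.setOutcome t (a₁, a₂, s')) *
        (G.meanReward s a₁ a₂ + G.γ * V s' - Q s a₁ a₂))
      = ∑ s', (β.1 t s a₁ * β.2 t s a₂ * h (p.setOutcome t (a₁, a₂, p.1 0))) *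
          (G.trans s a₁ a₂ s' * (G.meanReward s a₁ a₂ - Q s a₁ a₂) +
            G.γ * (G.trans s a₁ a₂ s' * V s')) := by
        refine Finset.sum_congr rfl fun s' _ => ?_
        rw [hh' p a₁ a₂ s' (p.1 0), Game.stepProb]
        ring
    _ = 0 := by
        rw [← Finset.mul_sum, Finset.sum_add_distrib, ← Finset.sum_mul, G.sum_trans,
          ← Finset.mul_sum, hq]
        ring

/-- Change of measure at one step: a function of the state and the actions of step `t`, reweighted
from the behavior profile `β` to the profile `π`, averages to the mean over the actions of `π`. -/
lemma Game.sum_pathWeight_reweight (β π : Profile S A₁ A₂ T) (t : Fin T)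
    (h : Path S A₁ A₂ T → ℝ) (hh : IsPrefixFunction t h) (f g : S → A₁ → A₂ → ℝ)
    (hfg : ∀ s a₁ a₂, β.1 t s a₁ * β.2 t s a₂ * g s a₁ a₂ =
      π.1 t s a₁ * π.2 t s a₂ * f s a₁ a₂) :
    ∑ p, G.pathWeight β p * (h p * g (p.1 t.castSucc) (p.2.1 t) (p.2.2 t)) =
      ∑ p, G.pathWeight β p * (h p * ∑ a₁, ∑ a₂, π.1 t (p.1 t.castSucc) a₁ *
        π.2 t (p.1 t.castSucc) a₂ * f (p.1 t.castSucc) a₁ a₂) := by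
  rw [G.sum_pathWeight_eq_average β t _ ((hh.mono (Nat.le_succ _)).mul (isPrefixFunction_step t
    fun s a₁ a₂ _ => g s a₁ a₂))]
  refine Finset.sum_congr rfl fun p _ => congrArg _ ?_
  simp only [p.setOutcome_fst_castSucc le_rfl, Path.setOutcome_act₁_self,
    Path.setOutcome_act₂_self, hh t le_rfl]
  simp only [← hfg]
  rw [← G.sum_stepProb_mul β t (p.1 t.castSucc) (g (p.1 t.castSucc)), Finset.mul_sum]
  exact Finset.sum_congr rfl fun y _ => by ring

/-- The discounted state values along a path telescope to the value of the initial state. -/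
lemma sum_telescope_stateValue (γ : ℝ) (N : Nuisance S A₁ A₂ T) (π : Profile S A₁ A₂ T)
    (p : Path S A₁ A₂ T) (c : ℕ → ℝ) (hc : c 0 = 1) :
    ∑ t : Fin T, γ ^ (t : ℕ) * (c t * stateValue γ N π t.castSucc (p.1 t.castSucc) -
      γ * (c (t + 1) * stateValue γ N π t.succ (p.1 t.succ))) = stateValue γ N π 0 (p.1 0) := by
  set f : Fin (T + 1) → ℝ := fun j => γ ^ (j : ℕ) * (c j * stateValue γ N π j (p.1 j)) with hf
  have h1 := Fin.sum_univ_succ f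
  have h2 := Fin.sum_univ_castSucc f
  have hl : f (Fin.last T) = 0 := by simp [hf, stateValue_last]
  have h0 : f 0 = stateValue γ N π 0 (p.1 0) := by simp [hf, hc]
  have h3 : ∑ t : Fin T, γ ^ (t : ℕ) * (c t * stateValue γ N π t.castSucc (p.1 t.castSucc) -
      γ * (c (t + 1) * stateValue γ N π t.succ (p.1 t.succ))) =
      ∑ t : Fin T, f t.castSucc - ∑ t : Fin T, f t.succ := by
    rw [← Finset.sum_sub_distrib]
    refine Finset.sum_congr rfl fun t _ => ?_
    simp only [hf, Fin.val_castSucc, Fin.val_succ, pow_succ]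
    ring
  rw [h3]
  linarith

end Bellman

/-! ### The bias of the doubly robust score -/

section Bias

variable {S A₁ A₂ : Type*} [Fintype S] [Fintype A₁] [Fintype A₂]
  [MeasurableSpace S] [MeasurableSpace A₁] [MeasurableSpace A₂]
  [MeasurableSingletonClass S] [MeasurableSingletonClass A₁] [MeasurableSingletonClass A₂] {T : ℕ}

lemma Traj.measurable_path : Measurable (Traj.path : Traj S A₁ A₂ T → Path S A₁ A₂ T) := by
  unfold Traj.path; fun_prop

lemma Traj.measurable_rew (t : Fin T) : Measurable fun τ : Traj S A₁ A₂ T => τ.rew t := by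
  unfold Traj.rew; fun_prop

/-- The doubly robust score is affine in the rewards. -/
lemma drScore_traj (γ : ℝ) (N : Nuisance S A₁ A₂ T) (π : Profile S A₁ A₂ T)
    (p : Path S A₁ A₂ T) (r : Fin T → ℝ) :
    drScore γ N π (p.traj r) = ∑ t : Fin T, (γ ^ (t : ℕ) * partialRatio N π (t + 1) p * r t +
      γ ^ (t : ℕ) * (partialRatio N π t p * stateValue γ N π t.castSucc (p.1 t.castSucc) -
        partialRatio N π (t + 1) p *
          qValue γ N π t (p.1 t.castSucc) (p.2.1 t) (p.2.2 t))) := by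
  refine Finset.sum_congr rfl fun t _ => ?_
  rw [cumRatio_traj, prevCumRatio_traj]
  simp only [Path.traj, Traj.st, Traj.act₁, Traj.act₂, Traj.rew]
  ring

lemma measurable_drScore (γ : ℝ) (N : Nuisance S A₁ A₂ T) (π : Profile S A₁ A₂ T) :
    Measurable (drScore γ N π) := by
  have : drScore γ N π = fun τ => drScore γ N π (τ.path.traj τ.2.2.2) := rfl
  rw [this]
  simp only [drScore_traj]
  have hm : ∀ f : Path S A₁ A₂ T → ℝ, Measurable fun τ : Traj S A₁ A₂ T => f τ.path := fun f =>
    (measurable_of_countable f).comp Traj.measurable_path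
  refine Finset.measurable_fun_sum _ fun t _ => ((hm fun p =>
    γ ^ (t : ℕ) * partialRatio N π (t + 1) p).mul (Traj.measurable_rew t)).add (hm fun p =>
    γ ^ (t : ℕ) * (partialRatio N π t p * stateValue γ N π t.castSucc (p.1 t.castSucc) -
        partialRatio N π (t + 1) p * qValue γ N π t (p.1 t.castSucc) (p.2.1 t) (p.2.2 t)))

variable (G : Game S A₁ A₂) {Rmax : ℝ}
  (hReward : ∀ s a₁ a₂, ∀ᵐ r ∂(G.reward s a₁ a₂ : Measure ℝ), |r| ≤ Rmax)

include hReward in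
/-- The value of a profile is the mean of the value function at the initial state. -/
lemma Game.value_eq_sum_init (β π : Profile S A₁ A₂ T) :
    G.value π = ∑ s, G.init s * stateValue G.γ (G.nuisance β) π 0 s := by
  rw [Game.value, G.integral_law π hReward (c := fun t _ => G.γ ^ (t : ℕ)) (d := fun _ _ => 0)
    (Finset.measurable_fun_sum _ fun t _ => (Traj.measurable_rew t).const_mul _)
    (fun p r => by simp [Path.traj, Traj.rew]), ← G.sum_pathWeight_initial π]
  simp only [← sum_telescope_stateValue G.γ (G.nuisance β) π _ (fun _ => 1) rfl, Finset.mul_sum,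
    add_zero]
  refine Finset.sum_comm.trans (Eq.trans ?_ Finset.sum_comm)
  refine Finset.sum_congr rfl fun t _ => ?_
  have hpre : IsPrefixFunction (t : ℕ) fun _ : Path S A₁ A₂ T => (1 : ℝ) := fun _ _ _ _ => rfl
  have h1 := G.sum_pathWeight_temporalDifference π β π t _ (hpre.mono (Nat.le_succ _))
    fun _ _ _ _ _ => rfl
  have h2 := G.sum_pathWeight_reweight π π t _ hpre (qValue G.γ (G.nuisance β) π t)
    (qValue G.γ (G.nuisance β) π t) fun _ _ _ => rfl
  simp only [← stateValue_castSucc] at h2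
  rw [← sub_eq_zero] at h2 ⊢
  rw [← Finset.sum_sub_distrib] at h2 ⊢
  rw [← mul_zero (G.γ ^ (t : ℕ)), ← add_zero (0 : ℝ)]
  nth_rw 1 [← h1]
  rw [← h2, ← Finset.sum_add_distrib, Finset.mul_sum]
  exact Finset.sum_congr rfl fun p _ => by ring

include hReward in
/-- The bias of the doubly robust score is second order: it pairs the error of the density ratios
with the error of the state-action values. -/
lemma Game.integral_drScore_sub_value (β π : Profile S A₁ A₂ T) (N : Nuisance S A₁ A₂ T)
    (hβ : ∀ t s a₁ a₂, β.1 t s a₁ * β.2 t s a₂ = 0 → π.1 t s a₁ * π.2 t s a₂ = 0) :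
    ∫ τ, drScore G.γ N π τ ∂(G.law β) - G.value π =
      ∑ t : Fin T, G.γ ^ (t : ℕ) * ∑ p, G.pathWeight β p *
        ((partialRatio N π t p * ratio (G.nuisance β) π (p.traj 0) t -
          partialRatio N π (t + 1) p) *
          (qValue G.γ N π t (p.1 t.castSucc) (p.2.1 t) (p.2.2 t) -
            qValue G.γ (G.nuisance β) π t (p.1 t.castSucc) (p.2.1 t) (p.2.2 t))) := by
  set N₀ := G.nuisance β with hN₀
  rw [G.value_eq_sum_init hReward β π, ← hN₀, G.integral_law β hReward (measurable_drScore _ _ _)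
    (drScore_traj G.γ N π), ← G.sum_pathWeight_initial β]
  have hV : ∀ p : Path S A₁ A₂ T, stateValue G.γ N₀ π 0 (p.1 0) = _ := fun p =>
    (sum_telescope_stateValue G.γ N₀ π p (fun j => partialRatio N π j p)
      (partialRatio_zero N π p)).symm
  simp only [hV, Finset.mul_sum, ← Finset.sum_sub_distrib]
  refine Finset.sum_comm.trans (Finset.sum_congr rfl fun t _ => ?_)
  have h1 := G.sum_pathWeight_temporalDifference β β π t _
    (isPrefixFunction_partialRatio N π (t + 1)) (ignoresNextState_partialRatio N π t)
  have h2 := G.sum_pathWeight_reweight β π t _ (isPrefixFunction_partialRatio N π t)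
    (fun s a₁ a₂ => qValue G.γ N π t s a₁ a₂ - qValue G.γ N₀ π t s a₁ a₂)
    (fun s a₁ a₂ => π.1 t s a₁ * π.2 t s a₂ / (β.1 t s a₁ * β.2 t s a₂) *
      (qValue G.γ N π t s a₁ a₂ - qValue G.γ N₀ π t s a₁ a₂)) (fun s a₁ a₂ => by
        rw [← mul_assoc, mul_div_cancel_of_imp' (hβ t s a₁ a₂)])
  have h3 : ∀ s, ∑ a₁, ∑ a₂, π.1 t s a₁ * π.2 t s a₂ *
      (qValue G.γ N π t s a₁ a₂ - qValue G.γ N₀ π t s a₁ a₂) =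
      stateValue G.γ N π t.castSucc s - stateValue G.γ N₀ π t.castSucc s := fun s => by
    simp only [stateValue_castSucc, mul_sub, Finset.sum_sub_distrib]
  simp only [h3] at h2
  rw [← sub_eq_zero, ← Finset.sum_sub_distrib] at h2 ⊢
  rw [← mul_zero (G.γ ^ (t : ℕ)), ← sub_zero (0 : ℝ)]
  nth_rw 1 [← h1]
  rw [← h2, ← Finset.sum_sub_distrib, Finset.mul_sum]
  refine Finset.sum_congr rfl fun p _ => ?_
  have h4 : ratio N₀ π (p.traj 0) t =
      π.1 t (p.1 t.castSucc) (p.2.1 t) * π.2 t (p.1 t.castSucc) (p.2.2 t) /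
        (β.1 t (p.1 t.castSucc) (p.2.1 t) * β.2 t (p.1 t.castSucc) (p.2.2 t)) := rfl
  rw [h4]
  ring

end Bias

/-! ### Pointwise bounds for the bias -/

section BiasBound

variable {S A₁ A₂ : Type*} [Fintype S] [Fintype A₁] [Fintype A₂] {T : ℕ}

/-- A trajectory that stays at one state and repeats one pair of actions. -/
def constTraj (s : S) (a₁ : A₁) (a₂ : A₂) : Traj S A₁ A₂ T :=
  (fun _ => s, fun _ => a₁, fun _ => a₂, 0)

lemma modelProduct_self (N : Nuisance S A₁ A₂ T) (t : Fin T) (x : Traj S A₁ A₂ T) :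
    modelProduct N t t x = N.R (x.st t) (x.act₁ t) (x.act₂ t) := by
  simp [modelProduct]

lemma splice_st_self (x z : Traj S A₁ A₂ T) (t : Fin T) : (splice x z t).st t = z.st t := by
  simp [splice, Traj.st]

lemma splice_act₁_self (x z : Traj S A₁ A₂ T) (t : Fin T) :
    (splice x z t).act₁ t = z.act₁ t := by
  simp [splice, Traj.act₁]

lemma splice_act₂_self (x z : Traj S A₁ A₂ T) (t : Fin T) :
    (splice x z t).act₂ t = z.act₂ t := by
  simp [splice, Traj.act₂]

lemma splice_st_of_ne (x z : Traj S A₁ A₂ T) {t l : Fin T} (h : l ≠ t) :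
    (splice x z t).st l = x.st l := by
  simp [splice, Traj.st, Function.update_of_ne, h]

lemma splice_act₁_of_ne (x z : Traj S A₁ A₂ T) {t l : Fin T} (h : l ≠ t) :
    (splice x z t).act₁ l = x.act₁ l := by
  simp [splice, Traj.act₁, Function.update_of_ne, h]

lemma splice_act₂_of_ne (x z : Traj S A₁ A₂ T) {t l : Fin T} (h : l ≠ t) :
    (splice x z t).act₂ l = x.act₂ l := by
  simp [splice, Traj.act₂, Function.update_of_ne, h]

lemma splice_next (x z : Traj S A₁ A₂ T) {t l : Fin T} (h : t ≤ l) :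
    (splice x z t).next l = x.next l := by
  have : l.succ ≠ t.castSucc := fun h' => by
    have := congrArg Fin.val h'
    simp only [Fin.val_succ, Fin.val_castSucc] at this
    have : (t : ℕ) ≤ l := h
    omega
  simp [splice, Traj.next, Function.update_of_ne, this]

lemma splice_eq_self (x z : Traj S A₁ A₂ T) {t : Fin T} (hs : x.st t = z.st t)
    (h₁ : x.act₁ t = z.act₁ t) (h₂ : x.act₂ t = z.act₂ t) : splice x z t = x := by
  rw [splice, ← hs, ← h₁, ← h₂]
  simp [Traj.st, Traj.act₁, Traj.act₂]

lemma modelProduct_splice_succ (N : Nuisance S A₁ A₂ T) {t t₁ t' : Fin T}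
    (h₁ : (t₁ : ℕ) = t + 1) (h : t₁ ≤ t') (x z : Traj S A₁ A₂ T) :
    modelProduct N t t' (splice x z t) =
      N.P (z.st t) (z.act₁ t) (z.act₂ t) (x.st t₁) * modelProduct N t₁ t' x := by
  have hlt : t < t₁ := Fin.lt_def.2 (by omega)
  have hset : Finset.Ico t t' = insert t (Finset.Ico t₁ t') := by
    ext l
    simp only [Finset.mem_Ico, Finset.mem_insert, Fin.le_def, Fin.lt_def, Fin.ext_iff]
    have : (t₁ : ℕ) ≤ t' := h
    omega
  have hne : t' ≠ t := (hlt.trans_le h).ne'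
  have hnext : x.next t = x.st t₁ := congrArg x.1 (Fin.ext h₁.symm)
  unfold modelProduct
  rw [hset, Finset.prod_insert (by simp [hlt]), splice_st_of_ne x z hne, splice_act₁_of_ne x z hne,
    splice_act₂_of_ne x z hne, splice_st_self, splice_act₁_self, splice_act₂_self,
    splice_next x z le_rfl, hnext]
  have : ∀ l ∈ Finset.Ico t₁ t', N.P ((splice x z t).st l) ((splice x z t).act₁ l)
      ((splice x z t).act₂ l) ((splice x z t).next l) =
      N.P (x.st l) (x.act₁ l) (x.act₂ l) (x.next l) := by
    intro l hl
    have hl : t < l := hlt.trans_le (Finset.mem_Ico.1 hl).1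
    rw [splice_st_of_ne x z hl.ne', splice_act₁_of_ne x z hl.ne', splice_act₂_of_ne x z hl.ne',
      splice_next x z hl.le]
  rw [Finset.prod_congr rfl this]
  ring

/-- The state-action values of two models are close when the products of their transition
probabilities and mean rewards along all paths are.  The factors `c` and `c'` carry the products
over the steps that precede `t`, which makes the claim inductive in `t`. -/
lemma abs_qValue_sub_le {γ : ℝ} (hγ₀ : 0 ≤ γ) (hγ₁ : γ ≤ 1) (N N' : Nuisance S A₁ A₂ T)
    (π : Profile S A₁ A₂ T) (n : ℕ) : ∀ (t : Fin T), T - t ≤ n → ∀ (c c' ε : ℝ) (s : S) (a₁ : A₁)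
    (a₂ : A₂), (∀ t', t ≤ t' → ∀ x : Traj S A₁ A₂ T, x.st t = s → x.act₁ t = a₁ → x.act₂ t = a₂ →
      |c * modelProduct N t t' x - c' * modelProduct N' t t' x| ≤ ε) →
    |c * qValue γ N π t s a₁ a₂ - c' * qValue γ N' π t s a₁ a₂| ≤
      (1 + Fintype.card S) ^ n * ε := by
  induction n with
  | zero => intro t ht; have := t.2; omega
  | succ n ih =>
    intro t ht c c' ε s a₁ a₂ hx
    have h0 := hx t le_rfl (constTraj s a₁ a₂) rfl rfl rfl
    have hε : 0 ≤ ε := (abs_nonneg _).trans h0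
    rw [modelProduct_self, modelProduct_self] at h0
    change |c * N.R s a₁ a₂ - c' * N'.R s a₁ a₂| ≤ ε at h0
    -- the terms of the next step, one for each next state
    have h1 : ∀ s', |c * N.P s a₁ a₂ s' * stateValue γ N π t.succ s' -
        c' * N'.P s a₁ a₂ s' * stateValue γ N' π t.succ s'| ≤ (1 + Fintype.card S) ^ n * ε := by
      intro s'
      by_cases hT : (t : ℕ) + 1 < T
      · set t₁ : Fin T := ⟨t + 1, hT⟩ with ht₁
        have hs : t.succ = t₁.castSucc := Fin.ext rfl
        rw [hs, stateValue_castSucc, stateValue_castSucc]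
        have hsum : c * N.P s a₁ a₂ s' * ∑ a₁', ∑ a₂', π.1 t₁ s' a₁' * π.2 t₁ s' a₂' *
              qValue γ N π t₁ s' a₁' a₂' -
            c' * N'.P s a₁ a₂ s' * ∑ a₁', ∑ a₂', π.1 t₁ s' a₁' * π.2 t₁ s' a₂' *
              qValue γ N' π t₁ s' a₁' a₂' =
            ∑ a₁', ∑ a₂', π.1 t₁ s' a₁' * π.2 t₁ s' a₂' *
              (c * N.P s a₁ a₂ s' * qValue γ N π t₁ s' a₁' a₂' -
                c' * N'.P s a₁ a₂ s' * qValue γ N' π t₁ s' a₁' a₂') := by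
          simp only [Finset.mul_sum, ← Finset.sum_sub_distrib]
          exact Finset.sum_congr rfl fun _ _ => Finset.sum_congr rfl fun _ _ => by ring
        rw [hsum]
        refine π.abs_sum_le t₁ s' fun a₁' a₂' => ih t₁ (by simp only [ht₁]; omega) _ _ ε _ _ _ ?_
        intro t' ht' x hxs hx1 hx2
        have hm := fun M : Nuisance S A₁ A₂ T =>
          modelProduct_splice_succ M (t := t) (t₁ := t₁) rfl ht' x (constTraj s a₁ a₂)
        have htt : t ≤ t' := le_trans (Fin.le_def.2 (by simp [ht₁])) ht'
        have := hx t' htt (splice x (constTraj s a₁ a₂) t) (splice_st_self ..)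
          (splice_act₁_self ..) (splice_act₂_self ..)
        rw [hm N, hm N', hxs] at this
        simp only [mul_assoc]
        exact this
      · have hs : t.succ = Fin.last T := Fin.ext (by simp; omega)
        rw [hs, stateValue_last, stateValue_last]
        simp only [mul_zero, sub_zero, abs_zero]
        positivity
    have h2 : c * qValue γ N π t s a₁ a₂ - c' * qValue γ N' π t s a₁ a₂ =
        (c * N.R s a₁ a₂ - c' * N'.R s a₁ a₂) +
          γ * ∑ s', (c * N.P s a₁ a₂ s' * stateValue γ N π t.succ s' -
            c' * N'.P s a₁ a₂ s' * stateValue γ N' π t.succ s') := by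
      rw [Finset.sum_sub_distrib]
      simp only [qValue, mul_assoc, ← Finset.mul_sum]
      ring
    have h3 : |∑ s', (c * N.P s a₁ a₂ s' * stateValue γ N π t.succ s' -
            c' * N'.P s a₁ a₂ s' * stateValue γ N' π t.succ s')| ≤
        Fintype.card S * ((1 + Fintype.card S) ^ n * ε) := by
      refine (Finset.abs_sum_le_sum_abs _ _).trans ?_
      refine (Finset.sum_le_sum fun s' _ => h1 s').trans ?_
      simp
    have h4 : (1 : ℝ) ≤ (1 + Fintype.card S) ^ n := one_le_pow₀ (by simp)
    rw [h2]
    refine (abs_add_le _ _).trans ?_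
    rw [abs_mul, abs_of_nonneg hγ₀]
    have h5 := mul_le_mul hγ₁ h3 (abs_nonneg _) zero_le_one
    have h6 := mul_le_mul_of_nonneg_right h4 hε
    rw [pow_succ]
    linarith

lemma Policy.le_one {A : Type*} [Fintype A] (ρ : Policy S A T) (t : Fin T) (s : S) (a : A) :
    ρ t s a ≤ 1 := by
  rw [← ρ.sum_eq_one t s]
  exact Finset.single_le_sum (f := fun a => ρ t s a) (fun b _ => (ρ t s).2.1 b) (Finset.mem_univ a)

/-- Density ratios differ by no more than the inverse behavior probabilities, because policies take
values in `[0, 1]`. -/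
lemma abs_partialRatio_sub_le (N N' : Nuisance S A₁ A₂ T) (π : Profile S A₁ A₂ T)
    (p : Path S A₁ A₂ T) {ε : ℝ} (hε : 0 ≤ ε)
    (h : ∀ t, |inverseBehavior N t (p.traj 0) - inverseBehavior N' t (p.traj 0)| ≤ ε)
    {j : ℕ} (hj : j ≤ T) : |partialRatio N π j p - partialRatio N' π j p| ≤ ε := by
  rcases j with _ | j
  · simpa using hε
  · set t : Fin T := ⟨j, hj⟩
    set c := ∏ l ∈ Finset.Iic t, (π.1 l (p.1 l.castSucc) (p.2.1 l) * π.2 l (p.1 l.castSucc) (p.2.2 l))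
    have hM : ∀ M : Nuisance S A₁ A₂ T,
        partialRatio M π (j + 1) p = c * inverseBehavior M t (p.traj 0) := fun M => by
      rw [← cumRatio_traj M π p 0 t, cumRatio, inverseBehavior, ← Finset.prod_mul_distrib]
      exact Finset.prod_congr rfl fun l _ => by
        rw [ratio, mul_one_div]
        rfl
    have hc0 : 0 ≤ c := Finset.prod_nonneg fun l _ =>
      mul_nonneg ((π.1 l _).2.1 _) ((π.2 l _).2.1 _)
    have hc1 : c ≤ 1 := Finset.prod_le_one
      (fun l _ => mul_nonneg ((π.1 l _).2.1 _) ((π.2 l _).2.1 _))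
      (fun l _ => mul_le_one₀ (Policy.le_one π.1 _ _ _) ((π.2 l _).2.1 _) (Policy.le_one π.2 _ _ _))
    rw [hM, hM, ← mul_sub, abs_mul, abs_of_nonneg hc0]
    exact (mul_le_of_le_one_left (abs_nonneg _) hc1).trans (h t)

variable [MeasurableSpace S] [MeasurableSpace A₁] [MeasurableSpace A₂]
  [MeasurableSingletonClass S] [MeasurableSingletonClass A₁] [MeasurableSingletonClass A₂]
  (G : Game S A₁ A₂) {Rmax : ℝ}
  (hReward : ∀ s a₁ a₂, ∀ᵐ r ∂(G.reward s a₁ a₂ : Measure ℝ), |r| ≤ Rmax)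

include hReward in
/-- The bias of the doubly robust score is bounded by the product of the two nuisance errors, each
taken along the paths that the behavior profile can generate. -/
lemma Game.abs_integral_drScore_sub_value_le (β π : Profile S A₁ A₂ T) (N : Nuisance S A₁ A₂ T)
    {B ε₁ ε₂ : ℝ} (hε₁ : 0 ≤ ε₁) (hε₂ : 0 ≤ ε₂)
    (hB : ∀ t s a₁ a₂, π.1 t s a₁ * π.2 t s a₂ ≤ B * (β.1 t s a₁ * β.2 t s a₂))
    (h₁ : ∀ p : Path S A₁ A₂ T, 0 < G.pathWeight β p → ∀ t t' : Fin T, t ≤ t' →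
      ∀ q : Path S A₁ A₂ T, |modelProduct N t t' (splice (q.traj 0) (p.traj 0) t) -
        modelProduct (G.nuisance β) t t' (splice (q.traj 0) (p.traj 0) t)| ≤ ε₁)
    (h₂ : ∀ p : Path S A₁ A₂ T, 0 < G.pathWeight β p → ∀ t,
      |inverseBehavior N t (p.traj 0) - inverseBehavior (G.nuisance β) t (p.traj 0)| ≤ ε₂) :
    |∫ τ, drScore G.γ N π τ ∂(G.law β) - G.value π| ≤
      T * ((|B| + 1) * (1 + Fintype.card S) ^ T) * (ε₁ * ε₂) := by
  have hπ0 : ∀ t s a₁ a₂, 0 ≤ π.1 t s a₁ * π.2 t s a₂ := fun t s a₁ a₂ =>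
    mul_nonneg ((π.1 t s).2.1 _) ((π.2 t s).2.1 _)
  rw [G.integral_drScore_sub_value hReward β π N fun t s a₁ a₂ h =>
    le_antisymm (by simpa [h] using hB t s a₁ a₂) (hπ0 t s a₁ a₂)]
  set M : ℝ := (|B| + 1) * (1 + Fintype.card S) ^ T * (ε₁ * ε₂) with hM
  have hM0 : 0 ≤ M := by positivity
  have key : ∀ t : Fin T, ∀ p, 0 < G.pathWeight β p →
      |(partialRatio N π t p * ratio (G.nuisance β) π (p.traj 0) t - partialRatio N π (t + 1) p) *
        (qValue G.γ N π t (p.1 t.castSucc) (p.2.1 t) (p.2.2 t) -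
          qValue G.γ (G.nuisance β) π t (p.1 t.castSucc) (p.2.1 t) (p.2.2 t))| ≤ M := by
    intro t p hp
    have hq : |qValue G.γ N π t (p.1 t.castSucc) (p.2.1 t) (p.2.2 t) -
          qValue G.γ (G.nuisance β) π t (p.1 t.castSucc) (p.2.1 t) (p.2.2 t)| ≤
        (1 + Fintype.card S) ^ T * ε₁ := by
      have := abs_qValue_sub_le G.γ_nonneg G.γ_le_one N (G.nuisance β) π T t (Nat.sub_le _ _) 1 1 ε₁
        (p.1 t.castSucc) (p.2.1 t) (p.2.2 t) ?_
      · simpa only [one_mul] using this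
      · intro t' ht' x hs hx1 hx2
        have := h₁ p hp t t' ht' x.path
        rw [splice_eq_self _ _ (by exact hs) (by exact hx1) (by exact hx2)] at this
        rw [one_mul, one_mul]
        exact this
    have hβ : 0 < β.1 t (p.1 t.castSucc) (p.2.1 t) * β.2 t (p.1 t.castSucc) (p.2.2 t) := by
      refine lt_of_le_of_ne (mul_nonneg ((β.1 t _).2.1 _) ((β.2 t _).2.1 _)) fun h0 => hp.ne' ?_
      refine mul_eq_zero_of_right _ (Finset.prod_eq_zero (Finset.mem_univ t) ?_)
      rw [Game.stepProb, ← h0, zero_mul]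
    have hη : |ratio (G.nuisance β) π (p.traj 0) t| ≤ |B| := by
      change |π.1 t (p.1 t.castSucc) (p.2.1 t) * π.2 t (p.1 t.castSucc) (p.2.2 t) /
        (β.1 t (p.1 t.castSucc) (p.2.1 t) * β.2 t (p.1 t.castSucc) (p.2.2 t))| ≤ |B|
      rw [abs_of_nonneg (div_nonneg (hπ0 _ _ _ _) hβ.le), div_le_iff₀ hβ]
      exact (hB _ _ _ _).trans (mul_le_mul_of_nonneg_right (le_abs_self B) hβ.le)
    have hd : ∀ j ≤ T, |partialRatio N π j p - partialRatio (G.nuisance β) π j p| ≤ ε₂ :=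
      fun j hj => abs_partialRatio_sub_le N _ π p hε₂ (h₂ p hp) hj
    have hρ : |partialRatio N π t p * ratio (G.nuisance β) π (p.traj 0) t -
        partialRatio N π (t + 1) p| ≤ (|B| + 1) * ε₂ := by
      have e : partialRatio N π t p * ratio (G.nuisance β) π (p.traj 0) t -
          partialRatio N π (t + 1) p =
          (partialRatio N π t p - partialRatio (G.nuisance β) π t p) *
            ratio (G.nuisance β) π (p.traj 0) t -
          (partialRatio N π (t + 1) p - partialRatio (G.nuisance β) π (t + 1) p) := by
        rw [partialRatio_succ (G.nuisance β)]
        ring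
      rw [e]
      refine (abs_sub _ _).trans ?_
      rw [abs_mul]
      have h1 := mul_le_mul (hd t t.2.le) hη (abs_nonneg _) hε₂
      have h2 := hd (t + 1) t.2
      linarith
    rw [abs_mul]
    calc _ ≤ ((|B| + 1) * ε₂) * ((1 + Fintype.card S) ^ T * ε₁) :=
          mul_le_mul hρ hq (abs_nonneg _) (by positivity)
      _ = M := by rw [hM]; ring
  calc _ ≤ ∑ _t : Fin T, M := by
        refine (Finset.abs_sum_le_sum_abs _ _).trans (Finset.sum_le_sum fun t _ => ?_)
        rw [abs_mul, abs_of_nonneg (pow_nonneg G.γ_nonneg _)]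
        refine (mul_le_of_le_one_left (abs_nonneg _)
          (pow_le_one₀ G.γ_nonneg G.γ_le_one)).trans ?_
        refine (Finset.abs_sum_le_sum_abs _ _).trans ?_
        calc _ ≤ ∑ p, G.pathWeight β p * M := by
              refine Finset.sum_le_sum fun p _ => ?_
              rw [abs_mul, abs_of_nonneg (G.pathWeight_nonneg β p)]
              rcases (G.pathWeight_nonneg β p).eq_or_lt with h0 | h0
              · simp [← h0]
              · exact mul_le_mul_of_nonneg_left (key t p h0) h0.le
          _ = M := by rw [← Finset.sum_mul, G.sum_pathWeight, one_mul]
    _ = T * ((|B| + 1) * (1 + Fintype.card S) ^ T) * (ε₁ * ε₂) := by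
        simp [hM]
        ring

end BiasBound

/-! ### Hoeffding's inequality under sample splitting -/

section Hoeffding

open ProbabilityTheory

variable {X : Type*} [MeasurableSpace X] (P : Measure X) [IsProbabilityMeasure P]

/-- One-sided Hoeffding inequality for a bounded centered function of independent variables; `n` is
any bound for their number. -/
lemma measure_pi_sum_ge_le {ι : Type*} [Fintype ι] {g : X → ℝ} (hg : Measurable g) {b : ℝ}
    (hb : 0 < b) (hbd : ∀ᵐ x ∂P, |g x| ≤ b) {n : ℕ} (hn : Fintype.card ι ≤ n)
    {u : ℝ} (hu : 0 < u) :
    (Measure.pi fun _ : ι => P) {x | u ≤ ∑ i, (g (x i) - ∫ y, g y ∂P)} ≤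
      ENNReal.ofReal (Real.exp (-u ^ 2 / (2 * n * b ^ 2))) := by
  rcases isEmpty_or_nonempty ι with hι | hι
  · simp [not_le.2 hu]
  have hcard : (0 : ℝ) < Fintype.card ι := by exact_mod_cast Fintype.card_pos
  have hsub : HasSubgaussianMGF (fun x => g x - ∫ y, g y ∂P) ((‖b - -b‖₊ / 2) ^ 2) P :=
    hasSubgaussianMGF_of_mem_Icc hg.aemeasurable (hbd.mono fun x hx => abs_le.1 hx)
  have hc : (((‖b - -b‖₊ / 2) ^ 2 : NNReal) : ℝ) = b ^ 2 := by
    simp only [sub_neg_eq_add, NNReal.coe_pow, NNReal.coe_div, coe_nnnorm, Real.norm_eq_abs,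
      NNReal.coe_ofNat, ← two_mul, abs_mul, abs_two, mul_div_cancel_left₀ _ (two_ne_zero' ℝ), sq_abs]
  have hmeas : Measurable fun x => g x - ∫ y, g y ∂P := hg.sub_const _
  have hind : iIndepFun (fun i (x : ι → X) => g (x i) - ∫ y, g y ∂P) (Measure.pi fun _ : ι => P) :=
    iIndepFun_pi (X := fun _ x => g x - ∫ y, g y ∂P) fun _ => hmeas.aemeasurable
  have h := HasSubgaussianMGF.measure_sum_ge_le_of_iIndepFun hind (s := Finset.univ)
    (c := fun _ => (‖b - -b‖₊ / 2) ^ 2) (fun i _ => ?_) hu.le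
  · rw [← ofReal_measureReal]
    refine ENNReal.ofReal_le_ofReal (h.trans (Real.exp_le_exp.2 ?_))
    rw [neg_div, neg_div, neg_le_neg_iff, Finset.sum_const, Finset.card_univ, nsmul_eq_mul,
      NNReal.coe_mul, hc, NNReal.coe_natCast, mul_assoc]
    gcongr
  · refine HasSubgaussianMGF.of_map (X := fun x => g x - ∫ y, g y ∂P)
      (measurable_pi_apply i).aemeasurable ?_
    rwa [(measurePreserving_eval (fun _ : ι => P) i).map_eq]

/-- Two-sided Hoeffding inequality for a bounded function of independent variables. -/
lemma measure_pi_abs_sum_ge_le {ι : Type*} [Fintype ι] {g : X → ℝ} (hg : Measurable g) {b : ℝ}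
    (hb : 0 < b) (hbd : ∀ᵐ x ∂P, |g x| ≤ b) {n : ℕ} (hn : Fintype.card ι ≤ n)
    {u : ℝ} (hu : 0 < u) :
    (Measure.pi fun _ : ι => P) {x | u ≤ |∑ i, (g (x i) - ∫ y, g y ∂P)|} ≤
      ENNReal.ofReal (2 * Real.exp (-u ^ 2 / (2 * n * b ^ 2))) := by
  have h1 := measure_pi_sum_ge_le P (ι := ι) hg hb hbd hn hu
  have h2 := measure_pi_sum_ge_le P (ι := ι) hg.neg hb (by simpa using hbd) hn hu
  rw [two_mul, ENNReal.ofReal_add (Real.exp_nonneg _) (Real.exp_nonneg _)]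
  refine le_trans (measure_mono ?_) ((measure_union_le _ _).trans (add_le_add h1 h2))
  intro x hx
  have hx' : u ≤ |∑ i, (g (x i) - ∫ y, g y ∂P)| := hx
  rcases le_abs.1 hx' with h | h
  · exact Or.inl h
  · refine Or.inr ?_
    change u ≤ ∑ i, (-g (x i) - ∫ y, -g y ∂P)
    rw [integral_neg]
    refine h.trans_eq ?_
    rw [← Finset.sum_neg_distrib]
    exact Finset.sum_congr rfl fun i _ => by ring

variable {ι : Type*} [Fintype ι] (q : ι → Prop) [DecidablePred q]

/-- The deviation, over the indices that satisfy `q`, of a function that is fitted on the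
observations of the other indices. -/
noncomputable def splitDeviation (g : ({i // ¬ q i} → X) → X → ℝ) (x : ι → X) : ℝ :=
  ∑ i ∈ Finset.univ.filter q, (g (fun j => x j) (x i) - ∫ y, g (fun j => x j) y ∂P)

variable {q} {g : ({i // ¬ q i} → X) → X → ℝ}

lemma splitDeviation_eq (x : ι → X) : splitDeviation P q g x =
    ∑ i : Subtype q, (g (MeasurableEquiv.piEquivPiSubtypeProd (fun _ => X) q x).2
      ((MeasurableEquiv.piEquivPiSubtypeProd (fun _ => X) q x).1 i) -
      ∫ y, g (MeasurableEquiv.piEquivPiSubtypeProd (fun _ => X) q x).2 y ∂P) :=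
  Finset.sum_subtype (Finset.univ.filter q) (by simp)
    (fun i => g (fun j => x j) (x i) - ∫ y, g (fun j => x j) y ∂P)

lemma measurable_splitDeviation_aux (hg : Measurable (Function.uncurry g)) :
    Measurable fun z : (Subtype q → X) × ({i // ¬ q i} → X) =>
      ∑ i, (g z.2 (z.1 i) - ∫ y, g z.2 y ∂P) := by
  have hint : Measurable fun D => ∫ y, g D y ∂P :=
    hg.stronglyMeasurable.integral_prod_right.measurable
  refine Finset.measurable_fun_sum _ fun i _ => Measurable.sub ?_ (hint.comp measurable_snd)
  exact hg.comp (measurable_snd.prodMk ((measurable_pi_apply i).comp measurable_fst))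

lemma measurable_splitDeviation (hg : Measurable (Function.uncurry g)) :
    Measurable (splitDeviation P q g) := by
  rw [funext (splitDeviation_eq P (q := q) (g := g))]
  exact (measurable_splitDeviation_aux P hg).comp (MeasurableEquiv.measurable _)

/-- A property of the observations outside `q` that holds almost surely in the full sample holds
almost surely for these observations. -/
lemma ae_pi_of_ae_restrict {p : ({i // ¬ q i} → X) → Prop}
    (h : ∀ᵐ x ∂(Measure.pi fun _ : ι => P), p fun j => x j) :
    ∀ᵐ D ∂(Measure.pi fun _ : {i // ¬ q i} => P), p D := by
  have hmp := measurePreserving_piEquivPiSubtypeProd (fun _ : ι => P) q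
  have h1 : ∀ᵐ z ∂((Measure.pi fun _ : Subtype q => P).prod
      (Measure.pi fun _ : {i // ¬ q i} => P)), p z.2 := by
    refine (hmp.symm.quasiMeasurePreserving.ae h).mono fun z hz => ?_
    rw [← (MeasurableEquiv.piEquivPiSubtypeProd (fun _ => X) q).apply_symm_apply z]
    exact hz
  exact (Measure.ae_ae_of_ae_prod h1).exists.choose_spec

/-- Hoeffding's inequality conditionally on the observations outside `q`: the deviation of a
function fitted on these observations is sub-Gaussian, without any consistency of the fit. -/
lemma measure_splitDeviation_ge_le (hg : Measurable (Function.uncurry g)) {b : ℝ} (hb : 0 < b)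
    (hbd : ∀ᵐ D ∂(Measure.pi fun _ : {i // ¬ q i} => P), ∀ᵐ x ∂P, |g D x| ≤ b)
    {n : ℕ} (hn : Fintype.card ι ≤ n) {u : ℝ} (hu : 0 < u) :
    (Measure.pi fun _ : ι => P) {x | u ≤ |splitDeviation P q g x|} ≤
      ENNReal.ofReal (2 * Real.exp (-u ^ 2 / (2 * n * b ^ 2))) := by
  have hmp := measurePreserving_piEquivPiSubtypeProd (fun _ : ι => P) q
  set A : Set ((Subtype q → X) × ({i // ¬ q i} → X)) :=
    {z | u ≤ |∑ i, (g z.2 (z.1 i) - ∫ y, g z.2 y ∂P)|} with hA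
  have hAm : MeasurableSet A :=
    measurableSet_le measurable_const (measurable_splitDeviation_aux P hg).abs
  have hpre : {x | u ≤ |splitDeviation P q g x|} =
      MeasurableEquiv.piEquivPiSubtypeProd (fun _ => X) q ⁻¹' A := by
    ext x
    simp only [Set.mem_ofPred_eq, splitDeviation_eq P x, hA, Set.mem_preimage]
  rw [hpre, hmp.measure_preimage hAm.nullMeasurableSet, Measure.prod_apply_symm hAm]
  calc _ ≤ ∫⁻ _, ENNReal.ofReal (2 * Real.exp (-u ^ 2 / (2 * n * b ^ 2)))
        ∂(Measure.pi fun _ : {i // ¬ q i} => P) := by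
        refine lintegral_mono_ae (hbd.mono fun D hD => ?_)
        exact measure_pi_abs_sum_ge_le P (hg.of_uncurry_left) hb hD
          ((Fintype.card_subtype_le q).trans hn) hu
    _ = _ := by simp

end Hoeffding

/-! ### Measurability of the fitted scores -/

section Measurability

variable {S A₁ A₂ : Type*} [Fintype S] [Fintype A₁] [Fintype A₂] {T : ℕ}
  {Ω : Type*} [MeasurableSpace Ω]

/-- All components of a random nuisance are measurable. -/
structure MeasurableNuisance (N : Ω → Nuisance S A₁ A₂ T) : Prop where
  R : ∀ s a₁ a₂, Measurable fun ω => (N ω).R s a₁ a₂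
  P : ∀ s a₁ a₂ s', Measurable fun ω => (N ω).P s a₁ a₂ s'
  b₁ : ∀ t s a, Measurable fun ω => (N ω).b₁ t s a
  b₂ : ∀ t s a, Measurable fun ω => (N ω).b₂ t s a

variable {N : Ω → Nuisance S A₁ A₂ T} (hN : MeasurableNuisance N)

include hN

lemma MeasurableNuisance.qValue_of_stateValue (γ : ℝ) (π : Profile S A₁ A₂ T) (t : Fin T)
    (h : ∀ s, Measurable fun ω => stateValue γ (N ω) π t.succ s) (s : S) (a₁ : A₁) (a₂ : A₂) :
    Measurable fun ω => qValue γ (N ω) π t s a₁ a₂ :=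
  (hN.R s a₁ a₂).add ((Finset.measurable_fun_sum _ fun s' _ =>
    (hN.P s a₁ a₂ s').mul (h s')).const_mul γ)

lemma MeasurableNuisance.stateValue (γ : ℝ) (π : Profile S A₁ A₂ T) (j : Fin (T + 1)) :
    ∀ s, Measurable fun ω => stateValue γ (N ω) π j s := by
  induction j using Fin.reverseInduction with
  | last => intro s; simp only [stateValue_last]; exact measurable_const
  | cast t ih =>
    intro s
    simp only [stateValue_castSucc]
    exact Finset.measurable_fun_sum _ fun a₁ _ => Finset.measurable_fun_sum _ fun a₂ _ =>
      (hN.qValue_of_stateValue γ π t ih s a₁ a₂).const_mul _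

lemma MeasurableNuisance.qValue (γ : ℝ) (π : Profile S A₁ A₂ T) (t : Fin T) (s : S) (a₁ : A₁)
    (a₂ : A₂) : Measurable fun ω => qValue γ (N ω) π t s a₁ a₂ :=
  hN.qValue_of_stateValue γ π t (hN.stateValue γ π t.succ) s a₁ a₂

lemma MeasurableNuisance.partialRatio (π : Profile S A₁ A₂ T) (j : ℕ) (p : Path S A₁ A₂ T) :
    Measurable fun ω => partialRatio (N ω) π j p :=
  Finset.measurable_fun_prod _ fun l _ => Measurable.div measurable_const
    ((hN.b₁ l _ _).mul (hN.b₂ l _ _))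

lemma MeasurableNuisance.modelProduct (t t' : Fin T) (x : Traj S A₁ A₂ T) :
    Measurable fun ω => modelProduct (N ω) t t' x :=
  (hN.R _ _ _).mul (Finset.measurable_fun_prod _ fun _ _ => hN.P _ _ _ _)

lemma MeasurableNuisance.inverseBehavior (t : Fin T) (x : Traj S A₁ A₂ T) :
    Measurable fun ω => inverseBehavior (N ω) t x :=
  Finset.measurable_fun_prod _ fun l _ => Measurable.div measurable_const
    ((hN.b₁ l _ _).mul (hN.b₂ l _ _))

variable [MeasurableSpace S] [MeasurableSpace A₁] [MeasurableSpace A₂]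
  [MeasurableSingletonClass S] [MeasurableSingletonClass A₁] [MeasurableSingletonClass A₂]

lemma MeasurableNuisance.drScore (γ : ℝ) (π : Profile S A₁ A₂ T) :
    Measurable fun z : Ω × Traj S A₁ A₂ T => drScore γ (N z.1) π z.2 := by
  have : (fun z : Ω × Traj S A₁ A₂ T => ZeroSumOPE.drScore γ (N z.1) π z.2) =
    fun z => ZeroSumOPE.drScore γ (N z.1) π (z.2.path.traj z.2.2.2.2) := rfl
  rw [this]
  simp only [drScore_traj]
  -- a coefficient that is measurable in the nuisance for every path is jointly measurable
  have hm : ∀ f : Ω → Path S A₁ A₂ T → ℝ, (∀ p, Measurable fun ω => f ω p) →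
      Measurable fun z : Ω × Traj S A₁ A₂ T => f z.1 z.2.path := fun f hf =>
    (measurable_from_prod_countable_left (f := fun z : Ω × Path S A₁ A₂ T => f z.1 z.2) hf).comp
      (measurable_fst.prodMk (Traj.measurable_path.comp measurable_snd))
  refine Finset.measurable_fun_sum _ fun t _ => ((hm (fun ω p => _) fun p =>
    (hN.partialRatio π (t + 1) p).const_mul (γ ^ (t : ℕ))).mul
      ((Traj.measurable_rew t).comp measurable_snd)).add (hm (fun ω p =>
        γ ^ (t : ℕ) * (ZeroSumOPE.partialRatio (N ω) π t p *
          ZeroSumOPE.stateValue γ (N ω) π t.castSucc (p.1 t.castSucc) -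
        ZeroSumOPE.partialRatio (N ω) π (t + 1) p *
          ZeroSumOPE.qValue γ (N ω) π t (p.1 t.castSucc) (p.2.1 t) (p.2.2 t))) fun p => ?_)
  exact (((hN.partialRatio π t p).mul (hN.stateValue γ π t.castSucc _)).sub
    ((hN.partialRatio π (t + 1) p).mul (hN.qValue γ π t _ _ _))).const_mul (γ ^ (t : ℕ))

end Measurability

/-! ### Consequences of the convergence rates -/

section Rates

variable {S A₁ A₂ : Type*} [Fintype S] [Fintype A₁] [Fintype A₂]
  [MeasurableSpace S] [MeasurableSpace A₁] [MeasurableSpace A₂]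
  [MeasurableSingletonClass S] [MeasurableSingletonClass A₁] [MeasurableSingletonClass A₂] {T : ℕ}
  (G : Game S A₁ A₂) (β : Profile S A₁ A₂ T)

/-- Markov's inequality along one path: a mean square error of order `o(n ^ (-2 α))` makes the error
at a path of positive probability at most `n ^ (-α)`, with probability tending to one. -/
lemma Game.tendsto_measure_error {Ω : ℕ → Type*} [∀ n, MeasurableSpace (Ω n)]
    (μ : ∀ n, Measure (Ω n)) (F : ∀ n, Ω n → Path S A₁ A₂ T → ℝ)
    (hF : ∀ n p, Measurable fun ω => F n ω p) (α : ℝ)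
    (h : Tendsto (fun n : ℕ => ENNReal.ofReal ((n : ℝ) ^ (2 * α)) *
      ∫⁻ ω, ∫⁻ τ, ENNReal.ofReal ((F n ω τ.path) ^ 2) ∂(G.law β) ∂(μ n)) atTop (𝓝 0))
    (p : Path S A₁ A₂ T) (hp : 0 < G.pathWeight β p) :
    Tendsto (fun n : ℕ => μ n {ω | (n : ℝ) ^ (-α) < |F n ω p|}) atTop (𝓝 0) := by
  set w := ENNReal.ofReal (G.pathWeight β p) with hw
  have hw0 : w ≠ 0 := by simpa [hw] using hp
  have hwt : w ≠ ⊤ := ENNReal.ofReal_ne_top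
  have h' := ENNReal.Tendsto.const_mul (a := w⁻¹) h (Or.inr (ENNReal.inv_ne_top.2 hw0))
  rw [mul_zero] at h'
  refine tendsto_of_tendsto_of_tendsto_of_le_of_le' tendsto_const_nhds h'
    (Eventually.of_forall fun _ => zero_le) ?_
  filter_upwards [eventually_ge_atTop 1] with n hn
  have hn0 : (0 : ℝ) < n := by exact_mod_cast hn
  set I := ∫⁻ ω, ∫⁻ τ, ENNReal.ofReal ((F n ω τ.path) ^ 2) ∂(G.law β) ∂(μ n)
  have hI : w * ∫⁻ ω, ENNReal.ofReal ((F n ω p) ^ 2) ∂(μ n) ≤ I := by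
    rw [← lintegral_const_mul _ ((hF n p).pow_const 2).ennreal_ofReal]
    refine lintegral_mono fun ω => ?_
    rw [G.lintegral_law β (F' := fun p => ENNReal.ofReal ((F n ω p) ^ 2)) ?_ fun _ _ => rfl]
    · exact Finset.single_le_sum (f := fun p => ENNReal.ofReal (G.pathWeight β p) *
        ENNReal.ofReal ((F n ω p) ^ 2)) (fun _ _ => zero_le) (Finset.mem_univ p)
    · exact (measurable_of_countable fun p => ENNReal.ofReal ((F n ω p) ^ 2)).comp
        Traj.measurable_path
  have hmarkov := mul_meas_ge_le_lintegral (μ := μ n)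
    (((hF n p).pow_const 2).ennreal_ofReal) (ENNReal.ofReal (((n : ℝ) ^ (-α)) ^ 2))
  have hsub : {ω | (n : ℝ) ^ (-α) < |F n ω p|} ⊆
      {ω | ENNReal.ofReal (((n : ℝ) ^ (-α)) ^ 2) ≤ ENNReal.ofReal ((F n ω p) ^ 2)} := by
    intro ω hω
    refine ENNReal.ofReal_le_ofReal ?_
    rw [← sq_abs (F n ω p)]
    exact pow_le_pow_left₀ (by positivity) (le_of_lt hω) 2
  have hone : ENNReal.ofReal ((n : ℝ) ^ (2 * α)) * ENNReal.ofReal (((n : ℝ) ^ (-α)) ^ 2) = 1 := by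
    rw [← ENNReal.ofReal_mul (by positivity), ← Real.rpow_natCast, ← Real.rpow_mul hn0.le,
      ← Real.rpow_add hn0]
    simp [show 2 * α + -(α * 2) = 0 by ring]
  calc μ n {ω | (n : ℝ) ^ (-α) < |F n ω p|}
      ≤ μ n {ω | ENNReal.ofReal (((n : ℝ) ^ (-α)) ^ 2) ≤ ENNReal.ofReal ((F n ω p) ^ 2)} :=
        measure_mono hsub
    _ = w⁻¹ * (ENNReal.ofReal ((n : ℝ) ^ (2 * α)) * (w * (ENNReal.ofReal (((n : ℝ) ^ (-α)) ^ 2) *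
          μ n {ω | ENNReal.ofReal (((n : ℝ) ^ (-α)) ^ 2) ≤ ENNReal.ofReal ((F n ω p) ^ 2)}))) := by
        rw [mul_left_comm _ w, ← mul_assoc w⁻¹, ENNReal.inv_mul_cancel hw0 hwt, one_mul,
          ← mul_assoc, hone, one_mul]
    _ ≤ w⁻¹ * (ENNReal.ofReal ((n : ℝ) ^ (2 * α)) * I) := by
        gcongr
        exact (mul_le_mul_right hmarkov w).trans hI

end Rates

/-! ### Finite classes -/

section FiniteClass

variable {S A₁ A₂ : Type*} [Fintype S] [Fintype A₁] [Fintype A₂] {T : ℕ}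

/-- With finitely many states, a class with finite covering numbers is finite: on the constant state
trajectories, one for each state, two different profiles are at distance at least `1 / |S|`. -/
lemma finite_of_coveringNumber_ne_top [Nonempty S] {Pi : Set (Profile S A₁ A₂ T)}
    (h : coveringNumber (1 / ((Fintype.card S : ℝ) + 1)) Pi ≠ ⊤) : Pi.Finite := by
  classical
  set m := Fintype.card S with hm
  have hm1 : 1 ≤ m := Fintype.card_pos
  have hm0 : (0 : ℝ) < m := by exact_mod_cast hm1
  set x : Fin m → Fin T → S := fun i _ => (Fintype.equivFin S).symm i with hx
  have h1 : coveringNumberOn (1 / ((m : ℝ) + 1)) Pi x ≠ ⊤ := by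
    refine ne_top_of_le_ne_top h ?_
    exact le_iSup_of_le m (le_iSup_of_le hm1 (le_iSup_of_le x le_rfl))
  have h2 : ∃ F : Finset (Profile S A₁ A₂ T),
      ∀ π ∈ Pi, ∃ π' ∈ F, hammingDistance x π π' ≤ 1 / ((m : ℝ) + 1) := by
    by_contra hcon
    push Not at hcon
    refine h1 ?_
    simp only [coveringNumberOn, iInf_eq_top]
    intro F hF
    obtain ⟨π, hπ, hπ'⟩ := hcon F
    obtain ⟨π', hπ'F, hle⟩ := hF.2 π hπ
    exact absurd hle (not_le.2 (hπ' π' hπ'F))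
  obtain ⟨F, hF⟩ := h2
  refine F.finite_toSet.subset fun π hπ => ?_
  obtain ⟨π', hπ', hd⟩ := hF π hπ
  have hcard : hammingDistance x π π' < 1 / m :=
    hd.trans_lt (one_div_lt_one_div_of_lt hm0 (by linarith))
  unfold hammingDistance at hcard
  rw [div_lt_div_iff_of_pos_right hm0] at hcard
  have hzero : (Finset.univ.filter fun i : Fin m => (∃ t, π.1 t (x i t) ≠ π'.1 t (x i t)) ∨
      (∃ t, π.2 t (x i t) ≠ π'.2 t (x i t))).card = 0 := by
    have : ((Finset.univ.filter fun i : Fin m => (∃ t, π.1 t (x i t) ≠ π'.1 t (x i t)) ∨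
      (∃ t, π.2 t (x i t) ≠ π'.2 t (x i t))).card : ℝ) < (1 : ℕ) := by
      rw [Nat.cast_one]
      convert hcard
    have := Nat.cast_lt.1 this
    omega
  rw [Finset.card_eq_zero, Finset.filter_eq_empty_iff] at hzero
  have heq : π = π' := by
    refine Prod.ext (funext fun t => funext fun s => ?_) (funext fun t => funext fun s => ?_)
    · have := @hzero (Fintype.equivFin S s) (Finset.mem_univ _)
      push Not at this
      simpa [hx] using this.1 t
    · have := @hzero (Fintype.equivFin S s) (Finset.mem_univ _)
      push Not at this
      simpa [hx] using this.2 t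
  rw [heq]
  exact hπ'

lemma entropyIntegral_nonneg (Pi : Set (Profile S A₁ A₂ T)) : 0 ≤ entropyIntegral Pi :=
  integral_nonneg fun _ => Real.sqrt_nonneg _

/-- Suprema over a finite set of two functions that are uniformly close are close. -/
lemma abs_sSup_image_sub_le {X : Type*} {A : Set X} (hA : A.Finite) (hne : A.Nonempty)
    {f g : X → ℝ} {ε : ℝ} (h : ∀ a ∈ A, |f a - g a| ≤ ε) :
    |sSup (f '' A) - sSup (g '' A)| ≤ ε := by
  have key : ∀ f g : X → ℝ, (∀ a ∈ A, |f a - g a| ≤ ε) → sSup (f '' A) ≤ sSup (g '' A) + ε := by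
    intro f g h
    refine csSup_le (hne.image f) ?_
    rintro _ ⟨a, ha, rfl⟩
    have h1 := le_csSup (hA.image g).bddAbove (Set.mem_image_of_mem g ha)
    have h2 := (abs_le.1 (h a ha)).2
    linarith
  have h1 := key f g h
  have h2 := key g f fun a ha => by rw [abs_sub_comm]; exact h a ha
  exact abs_le.2 ⟨by linarith, by linarith⟩

end FiniteClass

/-! ### The error of the cross-fitted value estimator -/

section CrossFit

variable {S A₁ A₂ : Type*} [Fintype S] [Fintype A₁] [Fintype A₂]
  [MeasurableSpace S] [MeasurableSpace A₁] [MeasurableSpace A₂]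
  [MeasurableSingletonClass S] [MeasurableSingletonClass A₁] [MeasurableSingletonClass A₂]
  {T K n : ℕ}

/-- A bound for the doubly robust score with density ratios bounded by powers of `B` and rewards
bounded by `Rmax`, increased by one so as to be positive. -/
noncomputable def scoreBound (T : ℕ) (B Rmax : ℝ) : ℝ :=
  T * (max 1 |B| ^ T * |Rmax| * (1 + 2 * T)) + 1

lemma scoreBound_pos (T : ℕ) (B Rmax : ℝ) : 0 < scoreBound T B Rmax := by
  unfold scoreBound
  positivity

lemma abs_drScore_le {γ : ℝ} (hγ₀ : 0 ≤ γ) (hγ₁ : γ ≤ 1) {N : Nuisance S A₁ A₂ T}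
    {π : Profile S A₁ A₂ T} {B Rmax : ℝ}
    (h : ∀ t : Fin T, (∀ τ, 0 ≤ cumRatio N π τ t ∧ cumRatio N π τ t ≤ B ^ ((t : ℕ) + 1)) ∧
      ∀ s a₁ a₂, |qValue γ N π t s a₁ a₂| ≤ ((T : ℝ) - (t : ℕ)) * Rmax)
    (τ : Traj S A₁ A₂ T) (hτ : ∀ t, |τ.rew t| ≤ Rmax) :
    |drScore γ N π τ| ≤ scoreBound T B Rmax := by
  set b := max 1 |B| with hb
  have hb1 : 1 ≤ b := le_max_left _ _
  have hR : Rmax ≤ |Rmax| := le_abs_self _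
  have hpart : ∀ j ≤ T, |partialRatio N π j τ.path| ≤ b ^ T := by
    intro j hj
    rcases j with _ | j
    · simpa using one_le_pow₀ hb1
    · have hc := (h ⟨j, hj⟩).1 (τ.path.traj 0)
      rw [cumRatio_traj] at hc
      rw [abs_of_nonneg hc.1]
      calc _ ≤ B ^ (j + 1) := hc.2
        _ ≤ |B| ^ (j + 1) := (le_abs_self _).trans_eq (abs_pow _ _)
        _ ≤ b ^ (j + 1) := pow_le_pow_left₀ (abs_nonneg _) (le_max_right _ _) _
        _ ≤ b ^ T := pow_le_pow_right₀ hb1 hj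
  have hQ : ∀ t s a₁ a₂, |qValue γ N π t s a₁ a₂| ≤ T * |Rmax| := by
    intro t s a₁ a₂
    have h0 : (0 : ℝ) ≤ (T : ℝ) - (t : ℕ) := sub_nonneg.2 (by exact_mod_cast t.2.le)
    refine ((h t).2 s a₁ a₂).trans ((mul_le_mul_of_nonneg_left hR h0).trans ?_)
    exact mul_le_mul_of_nonneg_right (by simp) (abs_nonneg _)
  have hV : ∀ (t : Fin T) s, |stateValue γ N π t.castSucc s| ≤ T * |Rmax| := by
    intro t s
    rw [stateValue_castSucc]
    exact π.abs_sum_le t s (hQ t s)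
  have hbT : (0 : ℝ) ≤ b ^ T := by positivity
  have hterm : ∀ t : Fin T, |γ ^ (t : ℕ) *
      (cumRatio N π τ t * (τ.rew t - qValue γ N π t (τ.st t) (τ.act₁ t) (τ.act₂ t)) +
        prevCumRatio N π τ t * stateValue γ N π t.castSucc (τ.st t))| ≤
      b ^ T * |Rmax| * (1 + 2 * T) := by
    intro t
    have e1 : cumRatio N π τ t = partialRatio N π (t + 1) τ.path :=
      cumRatio_traj N π τ.path τ.2.2.2 t
    have e2 : prevCumRatio N π τ t = partialRatio N π t τ.path :=
      prevCumRatio_traj N π τ.path τ.2.2.2 t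
    rw [e1, e2, abs_mul, abs_of_nonneg (pow_nonneg hγ₀ _)]
    refine (mul_le_of_le_one_left (abs_nonneg _) (pow_le_one₀ hγ₀ hγ₁)).trans ?_
    refine (abs_add_le _ _).trans ?_
    rw [abs_mul, abs_mul]
    have h1 : |τ.rew t - qValue γ N π t (τ.st t) (τ.act₁ t) (τ.act₂ t)| ≤
        |Rmax| + T * |Rmax| :=
      (abs_sub _ _).trans (add_le_add ((hτ t).trans hR) (hQ _ _ _ _))
    have h2 := mul_le_mul (hpart (t + 1) t.2) h1 (abs_nonneg _) hbT
    have h3 := mul_le_mul (hpart t t.2.le) (hV t (τ.st t)) (abs_nonneg _) hbT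
    linarith
  calc |drScore γ N π τ| ≤ ∑ _t : Fin T, b ^ T * |Rmax| * (1 + 2 * T) :=
        (Finset.abs_sum_le_sum_abs _ _).trans (Finset.sum_le_sum fun t _ => hterm t)
    _ ≤ scoreBound T B Rmax := by simp [scoreBound, ← hb]

variable (G : Game S A₁ A₂) (β : Profile S A₁ A₂ T) (e : Procedure S A₁ A₂ T K n)

/-- The deviation, over the fold `k`, of the score fitted outside this fold from its mean given the
fit. -/
noncomputable def Game.foldDeviation (k : Fin K) (π : Profile S A₁ A₂ T)
    (ω : Sample S A₁ A₂ T K n) : ℝ :=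
  splitDeviation (G.law β) (fun i => ω.1 i = k) (fun D τ => drScore G.γ (e ω.1 k D) π τ) ω.2

lemma Game.foldDeviation_eq (k : Fin K) (π : Profile S A₁ A₂ T) (ω : Sample S A₁ A₂ T K n) :
    G.foldDeviation β e k π ω = ∑ i ∈ Finset.univ.filter fun i => ω.1 i = k,
      (drScore G.γ (e.fit ω k) π (ω.2 i) - ∫ τ, drScore G.γ (e.fit ω k) π τ ∂(G.law β)) := rfl

/-- The estimation error is made up of the deviations over the folds and of the biases of the fitted
scores. -/
lemma Game.abs_drValue_sub_le (hn : 0 < n) (π : Profile S A₁ A₂ T) (ω : Sample S A₁ A₂ T K n)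
    {u c : ℝ} (hdev : ∀ k, |G.foldDeviation β e k π ω| ≤ u)
    (hbias : ∀ k, |∫ τ, drScore G.γ (e.fit ω k) π τ ∂(G.law β) - G.value π| ≤ c) :
    |drValue G.γ e ω π - G.value π| ≤ K * u / n + c := by
  have hn0 : (0 : ℝ) < n := by exact_mod_cast hn
  set m : Fin K → ℝ := fun k => ∫ τ, drScore G.γ (e.fit ω k) π τ ∂(G.law β) with hm
  have h1 : ∑ i : Fin n, (drScore G.γ (e.fit ω (ω.1 i)) π (ω.2 i) - m (ω.1 i)) =
      ∑ k, G.foldDeviation β e k π ω := by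
    rw [← Finset.sum_fiberwise Finset.univ ω.1]
    refine Finset.sum_congr rfl fun k _ => ?_
    rw [G.foldDeviation_eq]
    refine Finset.sum_congr rfl fun i hi => ?_
    rw [(Finset.mem_filter.1 hi).2]
  have h2 : drValue G.γ e ω π - G.value π =
      (∑ k, G.foldDeviation β e k π ω + ∑ i : Fin n, (m (ω.1 i) - G.value π)) / n := by
    rw [← h1, ← Finset.sum_add_distrib, drValue, eq_div_iff hn0.ne']
    simp only [sub_add_sub_cancel, Finset.sum_sub_distrib, Finset.sum_const, Finset.card_univ,
      Fintype.card_fin, nsmul_eq_mul]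
    field_simp
  have h3 : |∑ k, G.foldDeviation β e k π ω| ≤ K * u := by
    refine (Finset.abs_sum_le_sum_abs _ _).trans ((Finset.sum_le_sum fun k _ => hdev k).trans ?_)
    simp
  have h4 : |∑ i : Fin n, (m (ω.1 i) - G.value π)| ≤ n * c := by
    refine (Finset.abs_sum_le_sum_abs _ _).trans
      ((Finset.sum_le_sum fun i _ => hbias (ω.1 i)).trans ?_)
    simp
  rw [h2, abs_div, abs_of_pos hn0, div_le_iff₀ hn0, add_mul, div_mul_cancel₀ _ hn0.ne', mul_comm c]
  exact (abs_add_le _ _).trans (add_le_add h3 h4)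

variable {e}

lemma Procedure.IsMeasurable.measurableNuisance (he : e.IsMeasurable) (f : Fin n → Fin K)
    (k : Fin K) : MeasurableNuisance fun D => e f k D :=
  ⟨he.R f k, he.P f k, he.b₁ f k, he.b₂ f k⟩

lemma Procedure.IsMeasurable.measurableNuisance_fit (he : e.IsMeasurable) (k : Fin K) :
    MeasurableNuisance fun ω : Sample S A₁ A₂ T K n => e.fit ω k := by
  have h : ∀ F : Nuisance S A₁ A₂ T → ℝ, (∀ f, Measurable fun D => F (e f k D)) →
      Measurable fun ω : Sample S A₁ A₂ T K n => F (e.fit ω k) := fun F hF =>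
    measurable_from_prod_countable_right fun f => (hF f).comp
      (measurable_pi_lambda _ fun i => measurable_pi_apply _)
  exact ⟨fun s a₁ a₂ => h (fun N => N.R s a₁ a₂) fun f => he.R f k s a₁ a₂,
    fun s a₁ a₂ s' => h (fun N => N.P s a₁ a₂ s') fun f => he.P f k s a₁ a₂ s',
    fun t s a => h (fun N => N.b₁ t s a) fun f => he.b₁ f k t s a,
    fun t s a => h (fun N => N.b₂ t s a) fun f => he.b₂ f k t s a⟩

variable {ν : Measure (Fin n → Fin K)} [IsProbabilityMeasure ν]

instance : IsProbabilityMeasure (G.sampleLaw β ν) := by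
  unfold Game.sampleLaw; infer_instance

/-- Hoeffding's inequality for the deviation over one fold, conditionally on the folds and on the
observations outside the fold. -/
lemma Game.measure_foldDeviation_ge_le (he : e.IsMeasurable) {B Rmax : ℝ}
    (hReward : ∀ s a₁ a₂, ∀ᵐ r ∂(G.reward s a₁ a₂ : Measure ℝ), |r| ≤ Rmax)
    (k : Fin K) (π : Profile S A₁ A₂ T)
    (hEst : ∀ᵐ ω ∂(G.sampleLaw β ν), ∀ t : Fin T,
      (∀ τ, 0 ≤ cumRatio (e.fit ω k) π τ t ∧ cumRatio (e.fit ω k) π τ t ≤ B ^ ((t : ℕ) + 1)) ∧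
      ∀ s a₁ a₂, |qValue G.γ (e.fit ω k) π t s a₁ a₂| ≤ ((T : ℝ) - (t : ℕ)) * Rmax)
    {u : ℝ} (hu : 0 < u) :
    G.sampleLaw β ν {ω | u ≤ |G.foldDeviation β e k π ω|} ≤
      ENNReal.ofReal (2 * Real.exp (-u ^ 2 / (2 * n * scoreBound T B Rmax ^ 2))) := by
  set c := ENNReal.ofReal (2 * Real.exp (-u ^ 2 / (2 * n * scoreBound T B Rmax ^ 2)))
  have hg : ∀ f, Measurable (Function.uncurry fun D τ => drScore G.γ (e f k D) π τ) := fun f =>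
    (he.measurableNuisance f k).drScore G.γ π
  have hdev : Measurable (G.foldDeviation β e k π) :=
    measurable_from_prod_countable_right fun f => measurable_splitDeviation (G.law β) (hg f)
  have hA : MeasurableSet {ω | u ≤ |G.foldDeviation β e k π ω|} :=
    measurableSet_le measurable_const hdev.abs
  rw [Game.sampleLaw, Measure.prod_apply hA]
  have hae := Measure.ae_ae_of_ae_prod hEst
  calc _ ≤ ∫⁻ _, c ∂ν := by
        refine lintegral_mono_ae (hae.mono fun f hf => ?_)
        refine measure_splitDeviation_ge_le (q := fun i => f i = k) (G.law β) (hg f)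
          (scoreBound_pos T B Rmax) ?_ (by simp) hu
        refine ae_pi_of_ae_restrict (q := fun i => f i = k) (G.law β)
          (p := fun D => ∀ᵐ τ ∂(G.law β), |drScore G.γ (e f k D) π τ| ≤ scoreBound T B Rmax)
          (hf.mono fun x hx => ?_)
        exact (G.ae_law_rew β hReward).mono fun τ hτ =>
          abs_drScore_le G.γ_nonneg G.γ_le_one hx τ hτ
    _ = c := by simp

end CrossFit

/-! ### Nuisance errors along paths -/

section NuisanceError

variable {S A₁ A₂ : Type*} [Fintype S] [Fintype A₁] [Fintype A₂]
  [MeasurableSpace S] [MeasurableSpace A₁] [MeasurableSpace A₂]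
  [MeasurableSingletonClass S] [MeasurableSingletonClass A₁] [MeasurableSingletonClass A₂]
  {T K : ℕ}

/-- A finite union of events whose probabilities vanish has vanishing probability. -/
lemma tendsto_measure_iUnion_of_finite {ι : Type*} [Finite ι] {Ω : ℕ → Type*}
    [∀ n, MeasurableSpace (Ω n)] {μ : ∀ n, Measure (Ω n)} {A : ι → ∀ n, Set (Ω n)}
    (h : ∀ i, Tendsto (fun n => μ n (A i n)) atTop (𝓝 0)) :
    Tendsto (fun n => μ n (⋃ i, A i n)) atTop (𝓝 0) := by
  have := Fintype.ofFinite ι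
  have hsum := tendsto_finsetSum (Finset.univ : Finset ι) fun i _ => h i
  rw [Finset.sum_const_zero] at hsum
  exact tendsto_of_tendsto_of_tendsto_of_le_of_le tendsto_const_nhds hsum (fun _ => zero_le)
    fun n => measure_iUnion_fintype_le (μ n) fun i => A i n

/-- Along every path that `β` can generate, the model error of `N` is at most `ε₁` and the error of
its inverse behavior probabilities is at most `ε₂`. -/
def Game.NuisanceErrorLE (G : Game S A₁ A₂) (β : Profile S A₁ A₂ T) (N : Nuisance S A₁ A₂ T)
    (ε₁ ε₂ : ℝ) : Prop :=
  (∀ p : Path S A₁ A₂ T, 0 < G.pathWeight β p → ∀ t t' : Fin T, t ≤ t' →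
    ∀ q : Path S A₁ A₂ T, |modelProduct N t t' (splice (q.traj 0) (p.traj 0) t) -
      modelProduct (G.nuisance β) t t' (splice (q.traj 0) (p.traj 0) t)| ≤ ε₁) ∧
  ∀ p : Path S A₁ A₂ T, 0 < G.pathWeight β p → ∀ t,
    |inverseBehavior N t (p.traj 0) - inverseBehavior (G.nuisance β) t (p.traj 0)| ≤ ε₂

/-- The mean square rates yield the same rates along all paths, for all folds at once, with
probability tending to one. -/
lemma Game.tendsto_measure_not_nuisanceErrorLE (G : Game S A₁ A₂) (β : Profile S A₁ A₂ T)
    (ν : (n : ℕ) → Measure (Fin n → Fin K))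
    (e : (n : ℕ) → Procedure S A₁ A₂ T K n) (hMeas : ∀ n, (e n).IsMeasurable) (α₁ α₂ : ℝ)
    (hModel : ∀ (k : Fin K) (t t' : Fin T), t ≤ t' → ∀ x : Traj S A₁ A₂ T,
      Tendsto (fun n : ℕ => ENNReal.ofReal ((n : ℝ) ^ (2 * α₁)) *
        ∫⁻ ω, ∫⁻ τ, ENNReal.ofReal
          ((modelProduct ((e n).fit ω k) t t' (splice x τ t) -
            modelProduct (G.nuisance β) t t' (splice x τ t)) ^ 2)
          ∂(G.law β) ∂(G.sampleLaw β (ν n))) atTop (𝓝 0))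
    (hBehavior : ∀ (k : Fin K) (t : Fin T),
      Tendsto (fun n : ℕ => ENNReal.ofReal ((n : ℝ) ^ (2 * α₂)) *
        ∫⁻ ω, ∫⁻ τ, ENNReal.ofReal
          ((inverseBehavior ((e n).fit ω k) t τ -
            inverseBehavior (G.nuisance β) t τ) ^ 2)
          ∂(G.law β) ∂(G.sampleLaw β (ν n))) atTop (𝓝 0)) :
    Tendsto (fun n : ℕ => G.sampleLaw β (ν n)
      {ω | ¬ ∀ k, G.NuisanceErrorLE β ((e n).fit ω k) ((n : ℝ) ^ (-α₁)) ((n : ℝ) ^ (-α₂))})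
      atTop (𝓝 0) := by
  have hM := fun n k => (hMeas n).measurableNuisance_fit k
  have h1 := tendsto_measure_iUnion_of_finite
    (ι := {j : Fin K × Fin T × Fin T × Path S A₁ A₂ T × Path S A₁ A₂ T //
      j.2.1 ≤ j.2.2.1 ∧ 0 < G.pathWeight β j.2.2.2.1}) (fun j =>
    G.tendsto_measure_error β (fun n => G.sampleLaw β (ν n)) (fun n ω p =>
      modelProduct ((e n).fit ω j.1.1) j.1.2.1 j.1.2.2.1
          (splice (j.1.2.2.2.2.traj 0) (p.traj 0) j.1.2.1) -
        modelProduct (G.nuisance β) j.1.2.1 j.1.2.2.1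
          (splice (j.1.2.2.2.2.traj 0) (p.traj 0) j.1.2.1))
      (fun n p => ((hM n j.1.1).modelProduct _ _ _).sub_const _) α₁
      (hModel j.1.1 j.1.2.1 j.1.2.2.1 j.2.1 (j.1.2.2.2.2.traj 0)) j.1.2.2.2.1 j.2.2)
  have h2 := tendsto_measure_iUnion_of_finite
    (ι := {j : Fin K × Fin T × Path S A₁ A₂ T // 0 < G.pathWeight β j.2.2}) (fun j =>
    G.tendsto_measure_error β (fun n => G.sampleLaw β (ν n)) (fun n ω p =>
      inverseBehavior ((e n).fit ω j.1.1) j.1.2.1 (p.traj 0) -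
        inverseBehavior (G.nuisance β) j.1.2.1 (p.traj 0))
      (fun n p => ((hM n j.1.1).inverseBehavior _ _).sub_const _) α₂
      (hBehavior j.1.1 j.1.2.1) j.1.2.2 j.2)
  have h12 := h1.add h2
  rw [add_zero] at h12
  refine tendsto_of_tendsto_of_tendsto_of_le_of_le tendsto_const_nhds h12 (fun _ => zero_le)
    fun n => (measure_mono ?_).trans (measure_union_le _ _)
  intro ω hω
  by_contra hcon
  simp only [Set.mem_union, Set.mem_iUnion, not_or, not_exists, Set.mem_ofPred_eq, not_lt,
    Subtype.forall] at hcon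
  refine hω fun k => ⟨fun p hp t t' htt q => ?_, fun p hp t => ?_⟩
  · exact hcon.1 (k, t, t', p, q) ⟨htt, hp⟩
  · exact hcon.2 (k, t, p) hp

end NuisanceError

/-! ### Uniform error bound over finitely many profiles -/

section UniformBound

variable {S A₁ A₂ : Type*} [Fintype S] [Fintype A₁] [Fintype A₂]
  [MeasurableSpace S] [MeasurableSpace A₁] [MeasurableSpace A₂]
  [MeasurableSingletonClass S] [MeasurableSingletonClass A₁] [MeasurableSingletonClass A₂]
  {T K : ℕ}

/-- The logarithm of the number of events in a union bound is absorbed by a factor in front of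
`log (1 / δ)`, since `δ` stays below `1 / 2`. -/
lemma log_div_le {M δ : ℝ} (hM : 1 ≤ M) (hδ : 0 < δ) (hδ2 : δ < 1 / 2) :
    Real.log (M / δ) ≤ (Real.log M / Real.log 2 + 1) * Real.log (1 / δ) := by
  have h2 : 0 < Real.log 2 := Real.log_pos (by norm_num)
  have hl : Real.log 2 ≤ Real.log (1 / δ) :=
    Real.log_le_log (by norm_num) ((le_div_iff₀ hδ).2 (by linarith))
  have hM0 : 0 ≤ Real.log M := Real.log_nonneg hM
  rw [div_eq_mul_one_div M δ, Real.log_mul (by positivity) (by positivity), add_mul, one_mul]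
  gcongr
  rw [div_mul_eq_mul_div, le_div_iff₀ h2]
  exact mul_le_mul_of_nonneg_left hl hM0

/-- Over finitely many profiles with bounded density ratios, the cross-fitted doubly robust
estimator has error of order `√(log (1 / δ) / n)`: the fold deviations are controlled with
probability at least `1 - δ` for every `n`, and the biases with probability tending to one. -/
lemma Game.exists_uniform_error_bound (G : Game S A₁ A₂) (πb : Profile S A₁ A₂ T)
    (E : Finset (Profile S A₁ A₂ T)) (hE : E.Nonempty) (B Rmax : ℝ)
    (hOverlap : ∀ π ∈ E, ∀ t s a₁ a₂,
      π.1 t s a₁ * π.2 t s a₂ ≤ B * (πb.1 t s a₁ * πb.2 t s a₂))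
    (hReward : ∀ s a₁ a₂, ∀ᵐ r ∂(G.reward s a₁ a₂ : Measure ℝ), |r| ≤ Rmax) (hK : 1 ≤ K)
    (ν : (n : ℕ) → Measure (Fin n → Fin K)) (hν : ∀ n, IsProbabilityMeasure (ν n))
    (e : (n : ℕ) → Procedure S A₁ A₂ T K n) (hMeas : ∀ n, (e n).IsMeasurable)
    (hEst : ∀ n, ∀ᵐ ω ∂(G.sampleLaw πb (ν n)), ∀ k, ∀ π ∈ E, ∀ t : Fin T,
      (∀ τ, 0 ≤ cumRatio ((e n).fit ω k) π τ t ∧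
        cumRatio ((e n).fit ω k) π τ t ≤ B ^ ((t : ℕ) + 1)) ∧
      (∀ s a₁ a₂, |qValue G.γ ((e n).fit ω k) π t s a₁ a₂| ≤ ((T : ℝ) - (t : ℕ)) * Rmax))
    (α₁ α₂ : ℝ) (hα : 1 / 2 ≤ α₁ + α₂)
    (hNuisance : Tendsto (fun n : ℕ => G.sampleLaw πb (ν n)
      {ω | ¬ ∀ k, G.NuisanceErrorLE πb ((e n).fit ω k) ((n : ℝ) ^ (-α₁)) ((n : ℝ) ^ (-α₂))})
      atTop (𝓝 0)) :
    ∃ C : ℝ, 0 ≤ C ∧ ∀ δ : ℝ, 0 < δ → δ < 1 / 2 → ∃ N : ℕ, 0 < N ∧ ∀ n : ℕ, N ≤ n →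
      G.sampleLaw πb (ν n) {ω | ¬ ∀ π ∈ E, |drValue G.γ (e n) ω π - G.value π| ≤
        C * √(Real.log (1 / δ)) / √n} ≤ ENNReal.ofReal (2 * δ) := by
  set b := scoreBound T B Rmax with hb
  have hb0 : 0 < b := scoreBound_pos T B Rmax
  set J : ℝ := K * E.card with hJ
  have hJ1 : 1 ≤ J := by
    have h1 : (1 : ℝ) ≤ K := by exact_mod_cast hK
    have h2 : (1 : ℝ) ≤ E.card := by exact_mod_cast hE.card_pos
    exact one_le_mul_of_one_le_of_one_le h1 h2
  set κ : ℝ := Real.log (2 * J) / Real.log 2 + 1 with hκ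
  have hκ0 : 0 ≤ κ := add_nonneg (div_nonneg (Real.log_nonneg (by linarith))
    (Real.log_nonneg one_le_two)) zero_le_one
  set D : ℝ := T * ((|B| + 1) * (1 + Fintype.card S) ^ T) with hD
  have hD0 : 0 ≤ D := by positivity
  have hlog2 : 0 < Real.log 2 := Real.log_pos (by norm_num)
  refine ⟨K * (b * √(2 * κ)) + D / √(Real.log 2), by positivity, fun δ hδ hδ2 => ?_⟩
  obtain ⟨N, hN⟩ := eventually_atTop.1
    (hNuisance.eventually_le_const (ENNReal.ofReal_pos.2 hδ))
  refine ⟨max N 1, by positivity, fun n hn => ?_⟩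
  have hn1 : 1 ≤ n := (le_max_right _ _).trans hn
  have hn0 : (0 : ℝ) < n := by exact_mod_cast hn1
  have hsn : 0 < √(n : ℝ) := Real.sqrt_pos.2 hn0
  set ℓ := Real.log (1 / δ) with hℓ
  have hℓ2 : Real.log 2 ≤ ℓ :=
    Real.log_le_log (by norm_num) ((le_div_iff₀ hδ).2 (by linarith))
  -- the level of the fold deviations at which the union bound yields probability `δ`
  set L := Real.log (2 * J / δ) with hL
  have hL0 : 0 < L := Real.log_pos (by rw [lt_div_iff₀ hδ]; linarith)
  have hLκ : L ≤ κ * ℓ := log_div_le (by linarith) hδ hδ2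
  set u := b * √(2 * n * L) with hu
  have hu0 : 0 < u := by positivity
  have hexp : 2 * Real.exp (-u ^ 2 / (2 * n * b ^ 2)) = δ / J := by
    have : -u ^ 2 / (2 * n * b ^ 2) = -L := by
      rw [hu, mul_pow, Real.sq_sqrt (by positivity)]
      field_simp
    rw [this, Real.exp_neg, hL, Real.exp_log (by positivity)]
    field_simp
  have hdev : G.sampleLaw πb (ν n)
      (⋃ k : Fin K, ⋃ π ∈ E, {ω | u ≤ |G.foldDeviation πb (e n) k π ω|}) ≤ ENNReal.ofReal δ := by
    calc _ ≤ ∑ _k : Fin K, ∑ _π ∈ E, ENNReal.ofReal (δ / J) := by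
          refine (measure_iUnion_fintype_le _ _).trans (Finset.sum_le_sum fun k _ => ?_)
          refine (measure_biUnion_finset_le _ _).trans (Finset.sum_le_sum fun π hπ => ?_)
          rw [← hexp]
          exact G.measure_foldDeviation_ge_le πb (hMeas n) hReward k π
            ((hEst n).mono fun ω hω => hω k π hπ) hu0
      _ = ENNReal.ofReal δ := by
          simp only [Finset.sum_const, nsmul_eq_mul, Finset.card_univ, Fintype.card_fin]
          rw [← mul_assoc, ← Nat.cast_mul, ← ENNReal.ofReal_natCast,
            ← ENNReal.ofReal_mul (Nat.cast_nonneg _), Nat.cast_mul, ← hJ,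
            mul_div_cancel₀ _ (by positivity)]
  rw [two_mul δ, ENNReal.ofReal_add hδ.le hδ.le]
  refine (measure_mono ?_).trans ((measure_union_le _ _).trans
    (add_le_add hdev (hN n ((le_max_left _ _).trans hn))))
  intro ω hω
  by_contra hcon
  simp only [Set.mem_union, Set.mem_iUnion, not_or, not_exists, Set.mem_ofPred_eq, not_le,
    not_not] at hcon
  refine hω fun π hπ => ?_
  have hbias : ∀ k, |∫ τ, drScore G.γ ((e n).fit ω k) π τ ∂(G.law πb) - G.value π| ≤
      D * ((n : ℝ) ^ (-α₁) * (n : ℝ) ^ (-α₂)) := fun k =>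
    G.abs_integral_drScore_sub_value_le hReward πb π _ (by positivity) (by positivity)
      (hOverlap π hπ) (hcon.2 k).1 (hcon.2 k).2
  refine (G.abs_drValue_sub_le πb (e n) hn1 π ω (fun k => (hcon.1 k π hπ).le) hbias).trans ?_
  have hrate : (n : ℝ) ^ (-α₁) * (n : ℝ) ^ (-α₂) ≤ 1 / √n := by
    rw [← Real.rpow_add hn0, Real.sqrt_eq_rpow, one_div, ← Real.rpow_neg hn0.le]
    exact Real.rpow_le_rpow_of_exponent_le (by exact_mod_cast hn1) (by linarith)
  have h1 : K * u / n ≤ K * (b * √(2 * κ)) * √ℓ / √n := by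
    have e1 : √(2 * n * L) = √n * √(2 * L) := by
      rw [← Real.sqrt_mul hn0.le]
      congr 1
      ring
    have e2 : K * u / n = K * (b * √(2 * L)) / √n := by
      rw [hu, e1, div_eq_div_iff hn0.ne' hsn.ne']
      linear_combination (K * (b * √(2 * L))) * Real.mul_self_sqrt hn0.le
    have e3 : √(2 * L) ≤ √(2 * κ) * √ℓ := by
      rw [← Real.sqrt_mul (by positivity)]
      exact Real.sqrt_le_sqrt (by linarith)
    rw [e2]
    refine div_le_div_of_nonneg_right ?_ hsn.le
    calc K * (b * √(2 * L)) ≤ K * (b * (√(2 * κ) * √ℓ)) := by gcongr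
      _ = _ := by ring
  have h2 : D * ((n : ℝ) ^ (-α₁) * (n : ℝ) ^ (-α₂)) ≤ D / √(Real.log 2) * √ℓ / √n := by
    have hs2 : 0 < √(Real.log 2) := Real.sqrt_pos.2 hlog2
    calc _ ≤ D * (1 / √n) := mul_le_mul_of_nonneg_left hrate hD0
      _ = D * 1 / √n := by ring
      _ ≤ D * (√ℓ / √(Real.log 2)) / √n := by
          gcongr
          rw [le_div_iff₀ hs2, one_mul]
          exact Real.sqrt_le_sqrt hℓ2
      _ = _ := by ring
  calc _ ≤ K * (b * √(2 * κ)) * √ℓ / √n + D / √(Real.log 2) * √ℓ / √n := add_le_add h1 h2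
    _ = _ := by ring

/-- A uniform error of the value estimator is passed on, doubled, to the exploitability. -/
lemma Game.abs_classExploitability_sub_le (G : Game S A₁ A₂) {Pi₁ : Set (Policy S A₁ T)}
    {Pi₂ : Set (Policy S A₂ T)} (hf₁ : Pi₁.Finite) (hf₂ : Pi₂.Finite) (hPi₁ : Pi₁.Nonempty)
    (hPi₂ : Pi₂.Nonempty) (πe : Profile S A₁ A₂ T) {n : ℕ} (e : Procedure S A₁ A₂ T K n)
    (ω : Sample S A₁ A₂ T K n) {ε : ℝ}
    (h₁ : ∀ π₁ ∈ Pi₁, |drValue G.γ e ω (π₁, πe.2) - G.value (π₁, πe.2)| ≤ ε)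
    (h₂ : ∀ π₂ ∈ Pi₂, |drValue G.γ e ω (πe.1, π₂) - G.value (πe.1, π₂)| ≤ ε) :
    |G.classExploitability Pi₁ Pi₂ πe - drExploitability G.γ e Pi₁ Pi₂ πe ω| ≤ 2 * ε := by
  have e₁ := abs_sSup_image_sub_le hf₁ hPi₁ (f := fun π₁ => G.value (π₁, πe.2))
    (g := fun π₁ => drValue G.γ e ω (π₁, πe.2)) fun π₁ hπ => by
      rw [abs_sub_comm]; exact h₁ π₁ hπ
  have e₂ := abs_sSup_image_sub_le hf₂ hPi₂ (f := fun π₂ => -G.value (πe.1, π₂))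
    (g := fun π₂ => -drValue G.γ e ω (πe.1, π₂)) fun π₂ hπ => by
      rw [neg_sub_neg]; exact h₂ π₂ hπ
  rw [Game.classExploitability, drExploitability, add_sub_add_comm, two_mul]
  exact (abs_add_le _ _).trans (add_le_add e₁ e₂)

end UniformBound

end ZeroSumOPE

open ZeroSumOPE in
theorem theorem4
    {S A₁ A₂ : Type*} [Fintype S] [Fintype A₁] [Fintype A₂]
    [MeasurableSpace S] [MeasurableSpace A₁] [MeasurableSpace A₂]
    [MeasurableSingletonClass S] [MeasurableSingletonClass A₁] [MeasurableSingletonClass A₂]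
    {T : ℕ} (G : Game S A₁ A₂)
    -- behavior profile, target profile, policy classes
    (πb πe : Profile S A₁ A₂ T)
    (Pi₁ : Set (Policy S A₁ T)) (Pi₂ : Set (Policy S A₂ T))
    (hPi₁ : Pi₁.Nonempty) (hPi₂ : Pi₂.Nonempty)
    -- bounded density ratios and rewards
    (B Rmax : ℝ)
    (hOverlap : ∀ π ∈ evaluatedProfiles Pi₁ Pi₂ πe, ∀ t s a₁ a₂,
      π.1 t s a₁ * π.2 t s a₂ ≤ B * (πb.1 t s a₁ * πb.2 t s a₂))
    (hReward : ∀ s a₁ a₂, ∀ᵐ r ∂(G.reward s a₁ a₂ : Measure ℝ), |r| ≤ Rmax)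
    -- covering number of the class
    (D₁ D₂ w : ℝ) (hD₁ : 0 < D₁) (hD₂ : 0 < D₂) (hw₀ : 0 ≤ w) (hw : w < 1 / 2)
    (hCover : ∀ ε : ℝ, 0 < ε → ε < 1 →
      (coveringNumber ε (Pi₁ ×ˢ Pi₂) : ENNReal) ≤
        ENNReal.ofReal (D₁ * Real.exp (D₂ * (1 / ε) ^ w)))
    -- random balanced partitions into `K` folds
    (K : ℕ) (hK : 1 ≤ K)
    (ν : (n : ℕ) → Measure (Fin n → Fin K)) (hν : ∀ n, IsProbabilityMeasure (ν n))
    (hBalanced : ∀ n, ∀ᵐ f ∂(ν n), IsBalanced f)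
    -- cross-fitted estimates of the nuisance quantities, with bounded ratios and Q-functions
    (e : (n : ℕ) → Procedure S A₁ A₂ T K n) (hMeas : ∀ n, (e n).IsMeasurable)
    (hEst : ∀ n, ∀ᵐ ω ∂(G.sampleLaw πb (ν n)), ∀ k,
      ∀ π ∈ evaluatedProfiles Pi₁ Pi₂ πe, ∀ t : Fin T,
        (∀ τ, 0 ≤ cumRatio ((e n).fit ω k) π τ t ∧
          cumRatio ((e n).fit ω k) π τ t ≤ B ^ ((t : ℕ) + 1)) ∧
        (∀ s a₁ a₂, |qValue G.γ ((e n).fit ω k) π t s a₁ a₂| ≤ ((T : ℝ) - (t : ℕ)) * Rmax))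
    -- rates of convergence
    (α₁ α₂ : ℝ) (hα₁ : 0 < α₁) (hα₂ : 0 < α₂) (hα : 1 / 2 ≤ α₁ + α₂)
    (hModel : ∀ (k : Fin K) (t t' : Fin T), t ≤ t' → ∀ x : Traj S A₁ A₂ T,
      Tendsto (fun n : ℕ => ENNReal.ofReal ((n : ℝ) ^ (2 * α₁)) *
        ∫⁻ ω, ∫⁻ τ, ENNReal.ofReal
          ((modelProduct ((e n).fit ω k) t t' (splice x τ t) -
            modelProduct (G.nuisance πb) t t' (splice x τ t)) ^ 2)
          ∂(G.law πb) ∂(G.sampleLaw πb (ν n))) atTop (𝓝 0))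
    (hBehavior : ∀ (k : Fin K) (t : Fin T),
      Tendsto (fun n : ℕ => ENNReal.ofReal ((n : ℝ) ^ (2 * α₂)) *
        ∫⁻ ω, ∫⁻ τ, ENNReal.ofReal
          ((inverseBehavior ((e n).fit ω k) t τ -
            inverseBehavior (G.nuisance πb) t τ) ^ 2)
          ∂(G.law πb) ∂(G.sampleLaw πb (ν n))) atTop (𝓝 0))
    -- non-degeneracy
    (hUpsilon : 0 < G.upsilonDR πb (Pi₁ ×ˢ Pi₂)) :
    ∃ C : ℝ, 0 < C ∧ ∀ δ : ℝ, 0 < δ → ∃ N : ℕ, 0 < N ∧ ∀ n : ℕ, N ≤ n →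
      ENNReal.ofReal (1 - 2 * δ) ≤
        G.sampleLaw πb (ν n)
          {ω | |G.classExploitability Pi₁ Pi₂ πe - drExploitability G.γ (e n) Pi₁ Pi₂ πe ω| ≤
            C * (entropyIntegral (Pi₁ ×ˢ Pi₂) + √(Real.log (1 / δ))) *
              √(G.upsilonDR πb (Pi₁ ×ˢ Pi₂) / n)} := by
  have := G.nonempty_state
  have hclass : (Pi₁ ×ˢ Pi₂).Finite := by
    refine finite_of_coveringNumber_ne_top fun htop => ?_
    have hS : (0 : ℝ) < Fintype.card S := by exact_mod_cast Fintype.card_pos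
    have h := hCover (1 / ((Fintype.card S : ℝ) + 1)) (by positivity)
      ((div_lt_one (by positivity)).2 (by linarith))
    rw [htop] at h
    simp at h
  have hf₁ : Pi₁.Finite := by
    have h := hclass.image Prod.fst
    rwa [Set.fst_image_prod _ hPi₂] at h
  have hf₂ : Pi₂.Finite := by
    have h := hclass.image Prod.snd
    rwa [Set.snd_image_prod hPi₁] at h
  -- the profiles over which the two maxima of the exploitability are taken
  set E := ((hf₁.image fun π₁ => ((π₁, πe.2) : Profile S A₁ A₂ T)).union
    (hf₂.image fun π₂ => ((πe.1, π₂) : Profile S A₁ A₂ T))).toFinset with hE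
  have hE₁ : ∀ π₁ ∈ Pi₁, (π₁, πe.2) ∈ E := fun π₁ h =>
    (Set.Finite.mem_toFinset _).2 (Or.inl ⟨π₁, h, rfl⟩)
  have hE₂ : ∀ π₂ ∈ Pi₂, (πe.1, π₂) ∈ E := fun π₂ h =>
    (Set.Finite.mem_toFinset _).2 (Or.inr ⟨π₂, h, rfl⟩)
  have hEsub : ∀ π ∈ E, π ∈ evaluatedProfiles Pi₁ Pi₂ πe := by
    intro π hπ
    rcases (Set.Finite.mem_toFinset _).1 hπ with ⟨π₁, h, rfl⟩ | ⟨π₂, h, rfl⟩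
    · exact Or.inl (Or.inr ⟨h, rfl⟩)
    · exact Or.inr ⟨rfl, h⟩
  obtain ⟨C, hC0, hC⟩ := G.exists_uniform_error_bound πb E
    (hPi₁.elim fun π₁ h => ⟨_, hE₁ π₁ h⟩) B Rmax (fun π hπ => hOverlap π (hEsub π hπ)) hReward hK ν
    hν e hMeas (fun n => (hEst n).mono fun ω hω k π hπ => hω k π (hEsub π hπ)) α₁ α₂ hα
    (G.tendsto_measure_not_nuisanceErrorLE πb ν e hMeas α₁ α₂ hModel hBehavior)
  set Υ := G.upsilonDR πb (Pi₁ ×ˢ Pi₂) with hΥ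
  have hΥ0 : 0 < √Υ := Real.sqrt_pos.2 hUpsilon
  have hκ := entropyIntegral_nonneg (Pi₁ ×ˢ Pi₂)
  refine ⟨(2 * C + 1) / √Υ, by positivity, fun δ hδ => ?_⟩
  rcases le_or_gt (1 / 2) δ with hδ2 | hδ2
  · refine ⟨1, one_pos, fun n _ => ?_⟩
    rw [ENNReal.ofReal_of_nonpos (by linarith)]
    exact zero_le
  obtain ⟨N, hN0, hN⟩ := hC δ hδ hδ2
  refine ⟨N, hN0, fun n hn => ?_⟩
  have := hν n
  have hbad := hN n hn
  set good := {ω : Sample S A₁ A₂ T K n | ∀ π ∈ E, |drValue G.γ (e n) ω π - G.value π| ≤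
    C * √(Real.log (1 / δ)) / √n} with hgood
  -- outer measure suffices: the good event need not be measurable
  have hone : 1 ≤ G.sampleLaw πb (ν n) good + ENNReal.ofReal (2 * δ) := by
    rw [← measure_univ (μ := G.sampleLaw πb (ν n)), ← Set.union_compl_self good]
    exact (measure_union_le _ _).trans (add_le_add le_rfl hbad)
  rw [ENNReal.ofReal_sub _ (by positivity), ENNReal.ofReal_one]
  refine (tsub_le_iff_right.2 hone).trans (measure_mono fun ω hω => ?_)
  refine (G.abs_classExploitability_sub_le hf₁ hf₂ hPi₁ hPi₂ πe (e n) ω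
    (fun π₁ h => hω _ (hE₁ π₁ h)) fun π₂ h => hω _ (hE₂ π₂ h)).trans ?_
  rw [Real.sqrt_div hUpsilon.le]
  calc 2 * (C * √(Real.log (1 / δ)) / √n)
      = 2 * C * √(Real.log (1 / δ)) / √n := by ring
    _ ≤ (2 * C + 1) * (entropyIntegral (Pi₁ ×ˢ Pi₂) + √(Real.log (1 / δ))) / √n := by
        gcongr
        · linarith
        · linarith
    _ = (2 * C + 1) / √Υ * (entropyIntegral (Pi₁ ×ˢ Pi₂) + √(Real.log (1 / δ))) * (√Υ / √n) := by
        field_simp
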